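/- Let $\gamma>0$ be an ordinal and let $\mathbb P=\langle \mathbb P_\alpha,\tau_\alpha;\ \alpha<\gamma\rangle$ be a finite-support iteration of forcing notions: each $\tau_\alpha$ is a $\mathbb P_\alpha$-name for a poset with a largest element $1_{\tau_\alpha}$, and for every $\alpha\le\gamma$ the conditions of $\mathbb P_\alpha$ are the sequences $p$ of length $\alpha$ of names such that $p\restriction\beta\in\mathbb P_\beta$ and $p\restriction\beta\Vdash p(\beta)\in\tau_\beta$ for all $\beta<\alpha$, and $p(\beta)=1_{\tau_\beta}$ for all but finitely many $\beta<\alpha$, ordered by $p\le q$ iff $p\restriction\beta\Vdash p(\beta)\le q(\beta)$ for all $\beta<\alpha$. Write $\mathbb P$ also for $\mathbb P_\gamma$, and assume that $\mathbb P$ is ccc (every antichain is countable). Suppose that for each $\alpha<\gamma$ there is a poset $\mathbb Q_\alpha$ (in the ground model) such that $$\mathbb P_\alpha\Vdash\text{``if }\check{\mathbb Q}_\alpha\text{ is ccc, then }\tau_\alpha=\check{\mathbb Q}_\alpha\text{, and otherwise }\tau_\alpha\text{ is the trivial (one-element) poset''}.$$ Assume furthermore that $\mathbb P\Vdash\text{``}\check{\mathbb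 Q}_0\text{ is ccc''}$. Then there is a poset $\overline{\mathbb P}$ (which can be taken to be a partial order with a largest element) such that $\mathbb P$ is forcing equivalent to the product $\mathbb Q_0\times\overline{\mathbb P}$, i.e. both embed densely into a common poset. -/

import Mathlib

universe u

/-! ### Notions about a forcing poset in the ground model

A forcing poset is a type `P : Type u` with a reflexive and transitive relation `≤` (partial orders
are included), smaller conditions being stronger. -/

/-- Two conditions are compatible if they have a common extension. -/
def Compat {P : Type u} [Preorder P] (p q : P) : Prop := ∃ r, r ≤ p ∧ r ≤ q

/-- The countable chain condition: every antichain is countable. -/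
def IsCCC (P : Type u) [Preorder P] : Prop :=
  ∀ A : Set P, (∀ p ∈ A, ∀ q ∈ A, p ≠ q → ¬ Compat p q) → A.Countable

/-- Dense embeddings: maps that preserve order and incompatibility and have dense range. -/
structure IsDenseOrderEmbedding {P R : Type u} [Preorder P] [Preorder R] (e : P → R) : Prop where
  mono : ∀ p q, p ≤ q → e p ≤ e q
  incompat : ∀ p q, ¬ Compat p q → ¬ Compat (e p) (e q)
  dense : ∀ r, ∃ p, e p ≤ r

/-- Forcing equivalence: both posets embed densely into a common poset; equivalently, their Boolean
completions are isomorphic. -/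
def ForcingEquiv (P Q : Type u) [Preorder P] [Preorder Q] : Prop :=
  ∃ (R : Type u) (_ : Preorder R) (e : P → R) (f : Q → R), IsDenseOrderEmbedding e ∧ IsDenseOrderEmbedding f

/-! ### Names and the forcing relation -/

/-- `P`-names: sets of pairs (name, condition), the pairs being indexed by a type in `Type u`. -/
inductive PName (P : Type u) : Type (u + 1)
  | mk (I : Type u) (val : I → PName P) (cond : I → P) : PName P

namespace PName

/-- The unordered pair of two names. Here and below an element that is to be present for certain
is paired with every condition, which amounts to pairing it with a largest condition. -/
def upair {P : Type u} (x y : PName P) : PName P :=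
  mk (ULift.{u} Bool × P) (fun i => if i.1.down then x else y) (fun i => i.2)

/-- The (Kuratowski) ordered pair of two names. -/
def opair {P : Type u} (x y : PName P) : PName P :=
  upair (upair x x) (upair x y)

/-- The canonical name of a ground model set. -/
def check (P : Type u) : PSet.{u} → PName P
  | ⟨I, A⟩ => mk (I × P) (fun i => check P (A i.1)) (fun i => i.2)

/-- The canonical name of the range of a family `c` of ground model sets. -/
noncomputable def checkRange (P : Type u) {Q : Type u} (c : Q → ZFSet.{u}) : PName P :=
  mk (Q × P) (fun i => check P (c i.1).out) (fun i => i.2)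

/-- The canonical name of the order `{(c x, c y) | x ≤ y}` on the range of a family `c`. -/
noncomputable def checkOrder (P : Type u) {Q : Type u} [Preorder Q] (c : Q → ZFSet.{u}) : PName P :=
  mk ({x : Q × Q // x.1 ≤ x.2} × P)
    (fun i => opair (check P (c i.1.1.1).out) (check P (c i.1.1.2).out)) (fun i => i.2)

end PName

/-- A statement of the forcing language is represented by the predicate "`p` forces it". -/
abbrev FStmt (P : Type u) : Type u := P → Prop

namespace FStmt

variable {P : Type u} [Preorder P]

/-- `p ⊩ x = y`: whenever `q ≤ p` lies below the condition attached to an element of `x`, densely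
below `q` that element is forced to be equal to an element of `y`; and vice versa. -/
def eq : PName P → PName P → FStmt P
  | ⟨_, x, c⟩, ⟨_, y, d⟩ => fun p =>
    (∀ i, ∀ q ≤ p, q ≤ c i → ∃ r ≤ q, ∃ j, r ≤ d j ∧ eq (x i) (y j) r) ∧
    (∀ j, ∀ q ≤ p, q ≤ d j → ∃ r ≤ q, ∃ i, r ≤ c i ∧ eq (x i) (y j) r)

/-- `p ⊩ x ∈ y`. -/
def mem (x : PName P) : PName P → FStmt P
  | ⟨J, y, d⟩ => fun p => ∀ q ≤ p, ∃ r ≤ q, ∃ j : J, r ≤ d j ∧ eq x (y j) r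

/-- Negation. -/
def not (φ : FStmt P) : FStmt P := fun p => ∀ q ≤ p, ¬ φ q

/-- Conjunction. -/
def and (φ ψ : FStmt P) : FStmt P := fun p => φ p ∧ ψ p

/-- Implication. -/
def imp (φ ψ : FStmt P) : FStmt P := fun p => ∀ q ≤ p, φ q → ψ q

/-- Equivalence. -/
def iff (φ ψ : FStmt P) : FStmt P := and (imp φ ψ) (imp ψ φ)

/-- Universal quantification, in particular over all names. -/
def all {X : Type*} (φ : X → FStmt P) : FStmt P := fun p => ∀ x, φ x p

/-- Existential quantification, in particular over all names. -/
def ex {X : Type*} (φ : X → FStmt P) : FStmt P := fun p => ∀ q ≤ p, ∃ r ≤ q, ∃ x, φ x r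

/-- Universal quantification over the elements of `a`. -/
def ball (a : PName P) (φ : PName P → FStmt P) : FStmt P := all fun x => imp (mem x a) (φ x)

/-- Existential quantification over the elements of `a`. -/
def bex (a : PName P) (φ : PName P → FStmt P) : FStmt P := ex fun x => and (mem x a) (φ x)

/-- `(x, y) ∈ r`. -/
def rel (r x y : PName P) : FStmt P := mem (PName.opair x y) r

/-- `a` is countable: there is an injective function from `a` to `ω`. -/
def countable (a : PName P) : FStmt P :=
  ex fun f : PName P =>
    and (ball a fun x => bex (PName.check P PSet.omega) fun n => rel f x n)
      (ball a fun x => ball a fun y =>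
        ball (PName.check P PSet.omega) fun n => ball (PName.check P PSet.omega) fun m =>
          imp (rel f x n) (imp (rel f y m) (iff (eq x y) (eq n m))))

/-- `a` is an antichain of the poset `(t, r)`. -/
def antichain (t r a : PName P) : FStmt P :=
  and (ball a fun x => mem x t)
    (ball a fun x => ball a fun y =>
      imp (not (eq x y)) (not (bex t fun z => and (rel r z x) (rel r z y))))

/-- The poset `(t, r)` is ccc. -/
def ccc (t r : PName P) : FStmt P :=
  all fun a : PName P => imp (antichain t r a) (countable a)

/-- `r` is a reflexive and transitive relation on `t` with largest element `o ∈ t`. -/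
def poset (t r o : PName P) : FStmt P :=
  and (and (mem o t) (ball t fun x => rel r x o))
    (and (ball t fun x => rel r x x)
      (ball t fun x => ball t fun y => ball t fun z =>
        imp (rel r x y) (imp (rel r y z) (rel r x z))))

/-- `(t, r)` and `(t', r')` are the same poset. -/
def samePoset (t r t' r' : PName P) : FStmt P :=
  and (eq t t') (ball t fun x => ball t fun y => iff (rel r x y) (rel r' x y))

/-- `t` has exactly one element. -/
def singleton (t : PName P) : FStmt P := bex t fun x => ball t fun y => eq y x

end FStmt

/-- `P ⊩ φ`: every condition forces `φ`. -/
def Forced {P : Type u} (φ : FStmt P) : Prop := ∀ p, φ p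

/-- `p ⊩ "the ground model poset Q is ccc"`, where the elements of `Q` are the sets `c x`. -/
noncomputable def FStmt.checkCCC {P Q : Type u} [Preorder P] [Preorder Q] (c : Q → ZFSet.{u}) : FStmt P :=
  FStmt.ccc (PName.checkRange P c) (PName.checkOrder P c)

/-! ### Finite-support iterations -/

/-- Restriction to stage `b` of a sequence of length `a`. -/
def restrictSeq {ι : Type u} [LinearOrder ι] {C : ι → Type u} {a b : WithTop ι} (h : b ≤ a)
    (p : ∀ j : {j : ι // (j : WithTop ι) < a}, C j) :
    ∀ j : {j : ι // (j : WithTop ι) < b}, C j :=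
  fun j => p ⟨j.1, j.2.trans_le h⟩

/-- A finite-support iteration `⟨P_j, τ_j ; j ∈ ι⟩` along a well-order `ι`, which plays the role of
the ordinal length `γ`. The stages `P_a` are indexed by `a : WithTop ι`; the stage `⊤` is the whole
iteration (`P_γ`). A condition in `P_a` is a sequence of length `a` whose `j`-th coordinate is an
element of `Coord j`, an index set for a collection of `P_j`-names. That collection may be
the domain of the name `τ_j`, or all `P_j`-names for elements of `τ_j` up to equivalence, or
anything in between: it only has to exhaust `τ_j` in the sense of `exhaust`. -/
structure FSIteration (ι : Type u) [LinearOrder ι] [WellFoundedLT ι] where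
  /-- Indices for the names allowed as `j`-th coordinates. -/
  Coord : ι → Type u
  /-- The index of the largest element of the `j`-th iterand. -/
  one : ∀ j, Coord j
  /-- The conditions of the stage `P_a`. -/
  Cond : ∀ a : WithTop ι, Set (∀ j : {j : ι // (j : WithTop ι) < a}, Coord j)
  /-- The order of the stage `P_a`. -/
  [order : ∀ a, Preorder (Cond a)]
  /-- The `P_j`-name `τ_j` for (the underlying set of) the `j`-th iterand. -/
  name : ∀ j : ι, PName (Cond j)
  /-- The `P_j`-name for the order of the `j`-th iterand. -/
  ord : ∀ j : ι, PName (Cond j)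
  /-- The names allowed as `j`-th coordinates. -/
  val : ∀ j : ι, Coord j → PName (Cond j)
  /-- `P_j` forces the `j`-th iterand to be a poset with largest element. -/
  poset : ∀ j, Forced (FStmt.poset (name j) (ord j) (val j (one j)))
  /-- `P_j` forces each element of `τ_j` to be one of the names allowed as `j`-th coordinates. -/
  exhaust : ∀ j, Forced (FStmt.ball (name j) fun x => FStmt.ex fun s => FStmt.eq x (val j s))
  /-- `p` is in `P_a` iff it has finite support and, for each `j < a`, `p ↾ j` is in `P_j` and
  forces `p j` to be in `τ_j`. -/
  mem_cond_iff : ∀ a p, p ∈ Cond a ↔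
    {j | p j ≠ one j}.Finite ∧
    ∀ j : {j : ι // (j : WithTop ι) < a}, ∃ h : restrictSeq j.2.le p ∈ Cond j.1,
      FStmt.mem (val j (p j)) (name j) ⟨restrictSeq j.2.le p, h⟩
  /-- `p ≤ q` iff, for each `j < a`, `p ↾ j` forces `p j ≤ q j`. -/
  le_iff : ∀ a (p q : Cond a), p ≤ q ↔
    ∀ j : {j : ι // (j : WithTop ι) < a}, ∃ h : restrictSeq j.2.le p.1 ∈ Cond j.1,
      FStmt.rel (ord j) (val j (p.1 j)) (val j (q.1 j)) ⟨restrictSeq j.2.le p.1, h⟩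

namespace FSIteration

/-- The stage `P_a`, as a type. -/
abbrev Stage {ι : Type u} [LinearOrder ι] [WellFoundedLT ι] (I : FSIteration ι)
    (a : WithTop ι) : Type u := I.Cond a

instance {ι : Type u} [LinearOrder ι] [WellFoundedLT ι] (I : FSIteration ι) (a : WithTop ι) :
    Preorder (I.Stage a) := I.order a

/-- The `j`-th iterand of `I` is the ground model poset `Q` (with elements `c x`) if that poset is
ccc in the extension by `P_j`, and it is trivial otherwise. -/
def UsesIfCCC {ι : Type u} [LinearOrder ι] [WellFoundedLT ι] (I : FSIteration ι) (j : ι)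
    {Q : Type u} [Preorder Q] (c : Q → ZFSet.{u}) : Prop :=
  Forced (P := I.Stage j) <| FStmt.and
    (FStmt.imp (FStmt.checkCCC c)
      (FStmt.samePoset (I.name j) (I.ord j) (PName.checkRange _ c) (PName.checkOrder _ c)))
    (FStmt.imp (FStmt.not (FStmt.checkCCC c)) (FStmt.singleton (I.name j)))

end FSIteration

/-! A condition whose nontrivial coordinates are all decided is described by a finite partial
sequence `s` of elements of the posets `Q j`, with `⊤` off the support. Such conditions are dense
(`exists_realizes_le`), and their order is essentially coordinatewise (`Realizes.le`,
`Realizes.exists_le_of_le`). The sequences that arise are, up to refinement, the admissible ones: at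
each `j` in the support, every realized condition below the part of `s` before `j` forces `Q j` to
be ccc. So the iteration is equivalent to the admissible sequences. It splits as `Q ⊥` times the
sequences trivial at `⊥` once admissibility is known not to depend on the first coordinate.

That independence is `Good.update`, and it is where the chain conditions enter. Since `P` is ccc and
forces `Q ⊥` to be ccc, `P × Q ⊥` is ccc (`isCCC_prod_of_forced`). Conversely, `Q j` is forced to be
ccc by a condition of `P_j` below which `P_j × Q j` has only countable antichains
(`checkCCC_of_countable`). Given such an antichain below a sequence with altered first coordinate,
restore the old first coordinate. The entry at `j` can then be appended, because `Q j` is ccc there,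
and this gives a condition of `P`. Pair it with the forgotten element of `Q ⊥`. By induction on `j`
the first coordinates can be swapped back, so compatible pairs come from compatible members of the
antichain. Hence the antichain is countable.

Finally, conditions paired with sequences they realize map densely both to `P` and to the product,
and the regular open sets of this poset of pairs serve as the common target. -/

namespace FStmt

/-! ### Forced equality, membership and ordered pairs. -/

variable {P : Type u} [Preorder P]

theorem eq_mono {x y : PName P} {p q : P} (h : eq x y p) (hq : q ≤ p) : eq x y q := by
  cases x; cases y
  simp only [eq] at h ⊢
  exact ⟨fun i r hr => h.1 i r (hr.trans hq), fun j r hr => h.2 j r (hr.trans hq)⟩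

theorem eq_of_dense {x y : PName P} {p : P} (h : ∀ q ≤ p, ∃ r ≤ q, eq x y r) : eq x y p := by
  cases x; cases y
  simp only [eq] at h ⊢
  constructor
  · intro i q hq hi
    obtain ⟨r, hr, h1, -⟩ := h q hq
    obtain ⟨r', hr', j⟩ := h1 i r le_rfl (hr.trans hi)
    exact ⟨r', hr'.trans hr, j⟩
  · intro i q hq hi
    obtain ⟨r, hr, -, h1⟩ := h q hq
    obtain ⟨r', hr', j⟩ := h1 i r le_rfl (hr.trans hi)
    exact ⟨r', hr'.trans hr, j⟩

theorem eq_refl (x : PName P) (p : P) : eq x x p := by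
  induction x generalizing p with
  | mk I x c ih =>
    simp only [eq]
    exact ⟨fun i q _ hi => ⟨q, le_rfl, i, hi, ih i q⟩, fun i q _ hi => ⟨q, le_rfl, i, hi, ih i q⟩⟩

theorem eq_symm {x y : PName P} {p : P} (h : eq x y p) : eq y x p := by
  induction x generalizing y p with
  | mk I x c ih =>
    cases y
    simp only [eq] at h ⊢
    constructor
    · intro j q hq hj
      obtain ⟨r, hr, i, hi, e⟩ := h.2 j q hq hj
      exact ⟨r, hr, i, hi, ih i e⟩
    · intro j q hq hj
      obtain ⟨r, hr, i, hi, e⟩ := h.1 j q hq hj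
      exact ⟨r, hr, i, hi, ih j e⟩

theorem eq_trans {x y z : PName P} {p : P} (h : eq x y p) (h' : eq y z p) : eq x z p := by
  induction x generalizing y z p with
  | mk I x c ih =>
    cases y; cases z
    simp only [eq] at h h' ⊢
    constructor
    · intro i q hq hi
      obtain ⟨r, hr, j, hj, e⟩ := h.1 i q hq hi
      obtain ⟨r', hr', k, hk, e'⟩ := h'.1 j r (hr.trans hq) hj
      exact ⟨r', hr'.trans hr, k, hk, ih i (eq_mono e hr') e'⟩
    · intro k q hq hk
      obtain ⟨r, hr, j, hj, e⟩ := h'.2 k q hq hk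
      obtain ⟨r', hr', i, hi, e'⟩ := h.2 j r (hr.trans hq) hj
      exact ⟨r', hr'.trans hr, i, hi, ih i e' (eq_mono e hr')⟩

theorem mem_mono {x y : PName P} {p q : P} (h : mem x y p) (hq : q ≤ p) : mem x y q := by
  cases y
  exact fun r hr => h r (hr.trans hq)

theorem mem_of_dense {x y : PName P} {p : P} (h : ∀ q ≤ p, ∃ r ≤ q, mem x y r) : mem x y p := by
  cases y
  intro q hq
  obtain ⟨r, hr, h⟩ := h q hq
  obtain ⟨r', hr', h⟩ := h r le_rfl
  exact ⟨r', hr'.trans hr, h⟩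

theorem mem_congr_left {x x' y : PName P} {p : P} (e : eq x x' p) (h : mem x y p) :
    mem x' y p := by
  cases y
  intro q hq
  obtain ⟨r, hr, j, hj, h⟩ := h q hq
  exact ⟨r, hr, j, hj, eq_trans (eq_symm (eq_mono e (hr.trans hq))) h⟩

theorem mem_congr_right {x y y' : PName P} {p : P} (e : eq y y' p) (h : mem x y p) :
    mem x y' p := by
  cases y; cases y'
  simp only [eq] at e
  intro q hq
  obtain ⟨r, hr, j, hj, h⟩ := h q hq
  obtain ⟨r', hr', k, hk, h'⟩ := e.1 j r (hr.trans hq) hj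
  exact ⟨r', hr'.trans hr, k, hk, eq_trans (eq_mono h hr') h'⟩

theorem mem_upair_left (x y : PName P) (p : P) : mem x (PName.upair x y) p :=
  fun q _ => ⟨q, le_rfl, (⟨true⟩, q), le_rfl, by simpa using eq_refl x q⟩

theorem mem_upair_right (x y : PName P) (p : P) : mem y (PName.upair x y) p :=
  fun q _ => ⟨q, le_rfl, (⟨false⟩, q), le_rfl, by simpa using eq_refl y q⟩

theorem eq_or_eq_of_mem_upair {x y z : PName P} {p : P} (h : mem z (PName.upair x y) p) :
    ∃ r ≤ p, eq z x r ∨ eq z y r := by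
  obtain ⟨r, hr, ⟨⟨b⟩, _⟩, -, h⟩ := h p le_rfl
  cases b
  · exact ⟨r, hr, .inr (by simpa using h)⟩
  · exact ⟨r, hr, .inl (by simpa using h)⟩

theorem upair_congr {x x' y y' : PName P} {p : P} (hx : eq x x' p) (hy : eq y y' p) :
    eq (PName.upair x y) (PName.upair x' y') p := by
  simp only [PName.upair, eq]
  constructor <;>
  · rintro ⟨⟨b⟩, q'⟩ q hq hi
    refine ⟨q, le_rfl, (⟨b⟩, q'), hi, ?_⟩
    cases b
    · simpa using eq_mono hy hq
    · simpa using eq_mono hx hq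

theorem opair_congr {x x' y y' : PName P} {p : P} (hx : eq x x' p) (hy : eq y y' p) :
    eq (PName.opair x y) (PName.opair x' y') p :=
  upair_congr (upair_congr hx hx) (upair_congr hx hy)

theorem eq_of_upair_eq {x x' y y' : PName P} {p : P}
    (h : eq (PName.upair x y) (PName.upair x' y') p) :
    ∃ r ≤ p, (eq x x' r ∧ eq y y' r) ∨ (eq x y' r ∧ eq y x' r) := by
  have key : ∀ {x x' y y' : PName P} {p : P}, eq (PName.upair x y) (PName.upair x' y') p →
      eq x x' p → ∃ r ≤ p, eq x x' r ∧ eq y y' r := by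
    intro x x' y y' p h hx
    obtain ⟨r, hr, h1 | h1⟩ := eq_or_eq_of_mem_upair (mem_congr_right h (mem_upair_right x y p))
    · obtain ⟨s, hs, h2 | h2⟩ := eq_or_eq_of_mem_upair
        (mem_congr_right (eq_symm (eq_mono h hr)) (mem_upair_right x' y' r))
      · exact ⟨s, hs.trans hr, eq_mono hx (hs.trans hr), eq_trans (eq_mono h1 hs)
          (eq_trans (eq_symm (eq_mono hx (hs.trans hr))) (eq_symm h2))⟩
      · exact ⟨s, hs.trans hr, eq_mono hx (hs.trans hr), eq_symm h2⟩
    · exact ⟨r, hr, eq_mono hx hr, h1⟩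
  have swap : ∀ (x y : PName P) (p : P), eq (PName.upair x y) (PName.upair y x) p := by
    intro x y p
    simp only [PName.upair, eq]
    constructor <;>
    · rintro ⟨⟨b⟩, q'⟩ q hq hi
      exact ⟨q, le_rfl, (⟨!b⟩, q'), hi, by cases b <;> simpa using eq_refl _ q⟩
  obtain ⟨r, hr, h1 | h1⟩ := eq_or_eq_of_mem_upair (mem_congr_right h (mem_upair_left x y p))
  · obtain ⟨s, hs, h2⟩ := key (eq_mono h hr) h1
    exact ⟨s, hs.trans hr, .inl h2⟩
  · obtain ⟨s, hs, h2⟩ := key (eq_trans (eq_mono h hr) (swap x' y' r)) h1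
    exact ⟨s, hs.trans hr, .inr h2⟩

/-- Comparing unordered pairs decides which components match only after passing to an extension.
Forced equality is determined densely, so the conclusion holds at `p` itself. -/
theorem eq_of_opair_eq {x x' y y' : PName P} {p : P}
    (h : eq (PName.opair x y) (PName.opair x' y') p) : eq x x' p ∧ eq y y' p := by
  have key : ∀ q ≤ p, ∃ r ≤ q, eq x x' r ∧ eq y y' r := by
    intro q hq
    obtain ⟨r, hr, ⟨h1, h2⟩ | ⟨h1, h2⟩⟩ := eq_of_upair_eq (eq_mono h hq)
    · obtain ⟨s, hs, h1⟩ := eq_of_upair_eq h1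
      obtain ⟨t, ht, h2⟩ := eq_of_upair_eq (eq_mono h2 hs)
      have hx : eq x x' t := by
        rcases h1 with h1 | h1 <;> exact eq_mono h1.1 ht
      refine ⟨t, ht.trans (hs.trans hr), hx, ?_⟩
      rcases h2 with h2 | h2
      · exact h2.2
      · exact eq_trans h2.2 (eq_trans (eq_symm hx) h2.1)
    · obtain ⟨s, hs, h1⟩ := eq_of_upair_eq h1
      obtain ⟨t, ht, h2⟩ := eq_of_upair_eq (eq_mono h2 hs)
      have hx : eq x x' t ∧ eq x y' t := by
        rcases h1 with h1 | h1
        · exact ⟨eq_mono h1.1 ht, eq_mono h1.2 ht⟩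
        · exact ⟨eq_mono h1.2 ht, eq_mono h1.1 ht⟩
      have hy : eq y x' t := by rcases h2 with h2 | h2 <;> exact h2.2
      exact ⟨t, ht.trans (hs.trans hr), hx.1, eq_trans hy (eq_trans (eq_symm hx.1) hx.2)⟩
  constructor <;> refine eq_of_dense fun q hq => ?_ <;> obtain ⟨r, hr, h⟩ := key q hq
  · exact ⟨r, hr, h.1⟩
  · exact ⟨r, hr, h.2⟩

theorem rel_mono {r x y : PName P} {p q : P} (h : rel r x y p) (hq : q ≤ p) : rel r x y q :=
  mem_mono h hq

theorem rel_congr {r x x' y y' : PName P} {p : P} (hx : eq x x' p) (hy : eq y y' p)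
    (h : rel r x y p) : rel r x' y' p :=
  mem_congr_left (opair_congr hx hy) h

/-! ### Absoluteness for canonical names of ground model sets and posets. -/

theorem equiv_of_check_eq {a b : PSet.{u}} {p : P}
    (h : eq (PName.check P a) (PName.check P b) p) : a.Equiv b := by
  induction a generalizing b p with
  | mk I A ih =>
    cases b
    simp only [PName.check, eq] at h
    constructor
    · intro i
      obtain ⟨q, -, j, -, e⟩ := h.1 (i, p) p le_rfl le_rfl
      exact ⟨j.1, ih i e⟩
    · intro j
      obtain ⟨q, -, i, -, e⟩ := h.2 (j, p) p le_rfl le_rfl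
      exact ⟨i.1, ih i.1 e⟩

theorem ofNat_injective_of_equiv {m n : ℕ} (h : (PSet.ofNat.{u} m).Equiv (PSet.ofNat.{u} n)) :
    m = n := by
  have rk : ∀ n : ℕ, (PSet.ofNat.{u} n).rank = n := by
    intro n
    induction n with
    | zero => simp [PSet.ofNat]
    | succ n ih => simp [PSet.ofNat, PSet.rank_insert, ih]
  have := PSet.rank_congr h
  rw [rk, rk] at this
  exact_mod_cast this

theorem eq_of_check_ofNat {m n : ℕ} {p : P}
    (h : eq (PName.check P (PSet.ofNat.{u} m)) (PName.check P (PSet.ofNat n)) p) : m = n :=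
  ofNat_injective_of_equiv (equiv_of_check_eq h)

theorem mem_check_omega (n : ℕ) (p : P) :
    mem (PName.check P (PSet.ofNat.{u} n)) (PName.check P PSet.omega) p :=
  fun q _ => ⟨q, le_rfl, (⟨n⟩, q), le_rfl, eq_refl _ q⟩

theorem exists_of_mem_check_omega {x : PName P} {p : P}
    (h : mem x (PName.check P PSet.omega.{u}) p) :
    ∃ r ≤ p, ∃ n : ℕ, eq x (PName.check P (PSet.ofNat.{u} n)) r := by
  obtain ⟨r, hr, ⟨⟨n⟩, _⟩, -, h⟩ := h p le_rfl
  exact ⟨r, hr, n, h⟩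

section CheckPoset

variable {Q : Type u}

/-- The canonical name of the element `x` of a ground model poset. -/
noncomputable def elt (P : Type u) (c : Q → ZFSet.{u}) (x : Q) : PName P :=
  PName.check P (c x).out

theorem eq_of_elt_eq (c : Q ↪ ZFSet.{u}) {x y : Q} {p : P} (h : eq (elt P c x) (elt P c y) p) :
    x = y := by
  apply c.injective
  have := equiv_of_check_eq h
  rw [← Quotient.out_eq (c x), ← Quotient.out_eq (c y)]
  exact Quotient.sound this

theorem elt_mem (c : Q → ZFSet.{u}) (x : Q) (p : P) : mem (elt P c x) (PName.checkRange P c) p :=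
  fun q _ => ⟨q, le_rfl, (x, q), le_rfl, eq_refl _ q⟩

theorem exists_elt_of_mem {c : Q → ZFSet.{u}} {x : PName P} {p : P}
    (h : mem x (PName.checkRange P c) p) : ∃ r ≤ p, ∃ y, eq x (elt P c y) r := by
  obtain ⟨r, hr, ⟨y, _⟩, -, h⟩ := h p le_rfl
  exact ⟨r, hr, y, h⟩

variable [Preorder Q]

theorem rel_elt (c : Q → ZFSet.{u}) {x y : Q} (h : x ≤ y) (p : P) :
    rel (PName.checkOrder P c) (elt P c x) (elt P c y) p :=
  fun q _ => ⟨q, le_rfl, (⟨(x, y), h⟩, q), le_rfl, eq_refl _ q⟩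

theorem le_of_rel_elt (c : Q ↪ ZFSet.{u}) {x y : Q} {p : P}
    (h : rel (PName.checkOrder P c) (elt P c x) (elt P c y) p) : x ≤ y := by
  obtain ⟨r, hr, ⟨⟨⟨x', y'⟩, hxy⟩, _⟩, -, h⟩ := h p le_rfl
  obtain ⟨h1, h2⟩ := eq_of_opair_eq h
  obtain rfl := eq_of_elt_eq c h1
  obtain rfl := eq_of_elt_eq c h2
  exact hxy

end CheckPoset

end FStmt

/-! ### Countable families in ccc posets. -/

theorem Compat.refl {P : Type u} [Preorder P] (p : P) : Compat p p := ⟨p, le_rfl, le_rfl⟩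

/-- In a ccc poset, every family of pairwise incompatible conditions is countable. -/
theorem IsCCC.countable_of_family {X : Type u} [Preorder X] (hX : IsCCC X) {α : Type*} {A : Set α}
    (v : α → X) (hv : ∀ a ∈ A, ∀ b ∈ A, a ≠ b → ¬ Compat (v a) (v b)) : A.Countable := by
  have hinj : Set.InjOn v A := by
    intro a ha b hb hab
    by_contra hne
    exact hv a ha b hb hne (hab ▸ Compat.refl _)
  refine Set.countable_of_injective_of_countable_image hinj (hX _ ?_)
  rintro _ ⟨a, ha, rfl⟩ _ ⟨b, hb, rfl⟩ hne
  exact hv a ha b hb fun h => hne (h ▸ rfl)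

/-- In a ccc poset, every dense downward closed set has a countable subset that is predense. -/
theorem IsCCC.exists_countable_predense {P : Type u} [Preorder P] (hP : IsCCC P) {U : Set P}
    (hd : ∀ p, ∃ r ≤ p, r ∈ U) :
    ∃ W ⊆ U, W.Countable ∧ ∀ p, ∃ w ∈ W, Compat p w := by
  obtain ⟨W, hW⟩ := zorn_subset
    {W : Set P | W ⊆ U ∧ ∀ p ∈ W, ∀ q ∈ W, p ≠ q → ¬ Compat p q} (by
      intro K hK hchain
      refine ⟨⋃₀ K, ⟨Set.sUnion_subset fun W hW => (hK hW).1, ?_⟩,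
        fun W hW => Set.subset_sUnion_of_mem hW⟩
      rintro p ⟨V, hV, hp⟩ q ⟨V', hV', hq⟩ hne
      rcases hchain.total hV hV' with h | h
      · exact (hK hV').2 p (h hp) q hq hne
      · exact (hK hV).2 p hp q (h hq) hne)
  refine ⟨W, hW.prop.1, hP W hW.prop.2, fun p => ?_⟩
  obtain ⟨r, hr, hrU⟩ := hd p
  by_contra hno
  push Not at hno
  have hrW : r ∉ W := fun h => hno r h ⟨r, hr, le_rfl⟩
  have hno' : ∀ w ∈ W, ¬ Compat r w := fun w hw ⟨s, h1, h2⟩ => hno w hw ⟨s, h1.trans hr, h2⟩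
  refine hrW (hW.le_of_ge (y := insert r W)
    ⟨Set.insert_subset hrU hW.prop.1, ?_⟩ (Set.subset_insert r W) (Set.mem_insert r W))
  rintro p (rfl | hp) q (rfl | hq) hne
  · exact absurd rfl hne
  · exact hno' q hq
  · exact fun ⟨s, h1, h2⟩ => hno' p hp ⟨s, h2, h1⟩
  · exact hW.prop.2 p hp q hq hne

/-! ### Forcing that `Q` is ccc versus antichains of `P × Q`. -/

namespace FStmt

variable {P : Type u} [Preorder P]

variable {Q : Type u} [Preorder Q]

theorem checkCCC_mono {c : Q → ZFSet.{u}} {p q : P} (h : checkCCC c p) (hq : q ≤ p) :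
    checkCCC c q :=
  fun a s hs => h a s (hs.trans hq)

/-- If a ccc poset `P` forces that `Q` is ccc, then the product `P × Q` is ccc. -/
theorem isCCC_prod_of_forced (hP : IsCCC P) (c : Q ↪ ZFSet.{u})
    (h : Forced (P := P) (checkCCC c)) : IsCCC (P × Q) := by
  intro A hA
  -- The name of the set of all second coordinates of members of `A` whose first coordinate lies in
  -- the generic filter. It is forced to be an antichain.
  let a : PName P := .mk A (fun i => elt P c i.1.2) fun i => i.1.1
  have mem_a : ∀ i ∈ A, mem (elt P c i.2) a i.1 :=
    fun i hi q hq => ⟨q, le_rfl, ⟨i, hi⟩, hq, eq_refl _ q⟩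
  have of_mem_a : ∀ x p, mem x a p → ∃ r ≤ p, ∃ i ∈ A, r ≤ i.1 ∧ eq x (elt P c i.2) r := by
    intro x p hx
    obtain ⟨r, hr, i, hi, h⟩ := hx p le_rfl
    exact ⟨r, hr, i.1, i.2, hi, h⟩
  have anti : ∀ p, antichain (PName.checkRange P c) (PName.checkOrder P c) a p := by
    intro p
    refine ⟨fun x q _ hx => mem_of_dense fun q' hq' => ?_,
      fun x q _ hx y q₁ hq₁ hy q₂ hq₂ hne => ?_⟩
    · obtain ⟨r, hr, i, -, -, h⟩ := of_mem_a x q' (mem_mono hx hq')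
      exact ⟨r, hr, mem_congr_left (eq_symm h) (elt_mem _ _ _)⟩
    · intro q₃ hq₃ hz
      obtain ⟨r, hr, z, hz, hzx, hzy⟩ := hz q₃ le_rfl
      obtain ⟨r₁, hr₁, z₀, hz₀⟩ := exists_elt_of_mem hz
      obtain ⟨r₂, hr₂, i, hi, hi', hx⟩ := of_mem_a x r₁
        (mem_mono hx (hr₁.trans <| hr.trans <| hq₃.trans <| hq₂.trans hq₁))
      obtain ⟨r₃, hr₃, j, hj, hj', hy⟩ := of_mem_a y r₂
        (mem_mono hy (hr₂.trans <| hr₁.trans <| hr.trans <| hq₃.trans hq₂))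
      have hx' := eq_mono hx hr₃
      have hz' := eq_mono hz₀ (hr₃.trans hr₂)
      have h1 := le_of_rel_elt c (rel_congr hz' hx' (rel_mono hzx (hr₃.trans <| hr₂.trans hr₁)))
      have h2 := le_of_rel_elt c (rel_congr hz' hy (rel_mono hzy (hr₃.trans <| hr₂.trans hr₁)))
      by_cases hij : i = j
      · subst hij
        exact hne r₃ (hr₃.trans <| hr₂.trans <| hr₁.trans <| hr.trans hq₃)
          (eq_trans hx' (eq_symm hy))
      · exact hA i hi j hj hij ⟨(r₃, z₀), ⟨hr₃.trans hi', h1⟩, ⟨hj', h2⟩⟩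
  have hcount : ∀ p, countable a p := fun p => h p a p le_rfl (anti p)
  unfold countable at hcount
  -- The conditions that fix a name for an injection of `a` into `ω` are dense; countably many of
  -- them suffice.
  obtain ⟨W, hWU, hWc, hW⟩ := hP.exists_countable_predense (fun p => hcount p p le_rfl)
  have : Nonempty (PName P) := ⟨a⟩
  choose! f hf using fun w (hw : w ∈ W) => hWU hw
  have key : ∀ i ∈ A, ∃ r ≤ i.1, ∃ w ∈ W, r ≤ w ∧ ∃ k : ℕ,
      rel (f w) (elt P c i.2) (PName.check P (PSet.ofNat k)) r := by
    intro i hi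
    obtain ⟨w, hw, r, hr, hrw⟩ := hW i.1
    obtain ⟨r₁, hr₁, n, hn, hrel⟩ :=
      (hf w hw).1 (elt P c i.2) r hrw (mem_mono (mem_a i hi) hr) r le_rfl
    obtain ⟨r₂, hr₂, k, hk⟩ := exists_of_mem_check_omega hn
    exact ⟨r₂, hr₂.trans (hr₁.trans hr), w, hw, hr₂.trans (hr₁.trans hrw), k,
      rel_congr (eq_refl _ _) hk (rel_mono hrel hr₂)⟩
  obtain rfl | ⟨i₀, -⟩ := A.eq_empty_or_nonempty
  · exact Set.countable_empty
  have : Nonempty P := ⟨i₀.1⟩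
  choose! ρ hρ w hwW hρw k hk using key
  have hA' : A = ⋃ v ∈ W, ⋃ n : ℕ, {i ∈ A | w i = v ∧ k i = n} := by
    ext i
    simp only [Set.mem_iUnion, Set.mem_ofPred_eq]
    exact ⟨fun hi => ⟨w i, hwW i hi, k i, hi, rfl, rfl⟩, fun ⟨_, _, _, hi, _⟩ => hi⟩
  -- `A` is split by the chosen injection `w i` and the value `k i` it takes. Within one piece the
  -- conditions `ρ i` are pairwise incompatible: a common extension would force one injection to
  -- take the same value at two elements, making them equal.
  rw [hA']
  refine hWc.biUnion fun v hv => Set.countable_iUnion fun n => ?_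
  refine hP.countable_of_family ρ ?_
  rintro i ⟨hi, rfl, rfl⟩ j ⟨hj, hwj, hkj⟩ hij ⟨r, hri, hrj⟩
  have hki := rel_mono (hk i hi) hri
  have hkj' := rel_mono (hk j hj) hrj
  rw [hkj, hwj] at hkj'
  have := (hf _ hv).2 (elt P c i.2) r (hri.trans (hρw i hi))
    (mem_mono (mem_a i hi) (hri.trans (hρ i hi))) (elt P c j.2) r le_rfl
    (mem_mono (mem_a j hj) (hrj.trans (hρ j hj))) _ r le_rfl (mem_check_omega _ _) _ r le_rfl
    (mem_check_omega _ _) r le_rfl hki r le_rfl hkj'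
  have heq := eq_of_elt_eq c (this.2 r le_rfl (eq_refl _ r))
  exact hA i hi j hj hij ⟨(r, i.2), ⟨hri.trans (hρ i hi), le_rfl⟩,
    ⟨hrj.trans (hρ j hj), heq.le⟩⟩

/-- If all antichains below `(p, -)` in the product `P × Q` are countable, then `p` forces that `Q`
is ccc. -/
theorem checkCCC_of_countable (c : Q ↪ ZFSet.{u}) {p : P}
    (h : ∀ A : Set (P × Q), (∀ i ∈ A, i.1 ≤ p) → (∀ i ∈ A, ∀ j ∈ A, i ≠ j → ¬ Compat i j) →
      A.Countable) : checkCCC c p := by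
  intro a q hq ha
  -- The possible elements of `a` below `q`. Pairing each with a condition forcing it into `a`
  -- yields an antichain of `P × Q` below `p`, so `E` is countable, and an injection of `E` into `ℕ`
  -- in the ground model names the required one.
  let E : Set Q := {x | ∃ r ≤ q, mem (elt P c x) a r}
  have hE : E.Countable := by
    have : Nonempty P := ⟨q⟩
    choose! ρ hρ hmem using fun x (hx : x ∈ E) => hx
    have hinj : Set.InjOn (fun x => (ρ x, x)) E := fun x _ y _ hxy => (Prod.ext_iff.1 hxy).2
    refine Set.countable_of_injective_of_countable_image hinj (h _ ?_ ?_)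
    · rintro _ ⟨x, hx, rfl⟩
      exact (hρ x hx).trans hq
    · rintro _ ⟨x, hx, rfl⟩ _ ⟨y, hy, rfl⟩ hne ⟨⟨r, z⟩, ⟨hrx, hzx⟩, ⟨hry, hzy⟩⟩
      refine ha.2 (elt P c x) r (hrx.trans (hρ x hx)) (mem_mono (hmem x hx) hrx)
        (elt P c y) r le_rfl
        (mem_mono (hmem y hy) hry) r le_rfl ?_ r le_rfl ?_
      · intro s _ hs
        exact hne (by rw [eq_of_elt_eq c hs])
      · exact fun s _ => ⟨s, le_rfl, elt P c z, elt_mem _ _ _, rel_elt _ hzx _, rel_elt _ hzy _⟩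
  obtain ⟨g, hg⟩ := Set.countable_iff_exists_injOn.1 hE
  let nat (x : Q) : PName P := PName.check P (PSet.ofNat (g x))
  let f : PName P := .mk (E × P) (fun i => .opair (elt P c i.1.1) (nat i.1.1)) fun i => i.2
  have rel_f : ∀ x ∈ E, ∀ r, rel f (elt P c x) (nat x) r :=
    fun x hx r s _ => ⟨s, le_rfl, (⟨x, hx⟩, s), le_rfl, eq_refl _ _⟩
  have of_rel_f : ∀ x n r, rel f x n r →
      ∃ s ≤ r, ∃ x₀ ∈ E, eq x (elt P c x₀) s ∧ eq n (nat x₀) s := by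
    intro x n r hx
    obtain ⟨s, hs, ⟨x₀, _⟩, -, h⟩ := hx r le_rfl
    exact ⟨s, hs, x₀.1, x₀.2, eq_of_opair_eq h⟩
  refine fun q' hq' => ⟨q', le_rfl, f, ?_, ?_⟩
  · intro x r hr hx s hs
    obtain ⟨s₁, hs₁, x₀, hx₀⟩ := exists_elt_of_mem
      (ha.1 x s (hs.trans (hr.trans hq')) (mem_mono hx hs))
    refine ⟨s₁, hs₁, nat x₀, mem_check_omega _ _, rel_congr (eq_symm hx₀) (eq_refl _ _)
      (rel_f x₀ ?_ s₁)⟩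
    exact ⟨s₁, hs₁.trans (hs.trans (hr.trans hq')),
      mem_congr_left hx₀ (mem_mono hx (hs₁.trans hs))⟩
  · intro x r hr hx y r₁ hr₁ hy n r₂ hr₂ hn m r₃ hr₃ hm r₄ hr₄ hxn r₅ hr₅ hym
    have key : ∀ s ≤ r₅, ∃ t ≤ s, ∃ x₀ ∈ E, ∃ y₀ ∈ E, eq x (elt P c x₀) t ∧ eq n (nat x₀) t ∧
        eq y (elt P c y₀) t ∧ eq m (nat y₀) t := by
      intro s hs
      obtain ⟨t, ht, x₀, hx₀, h1, h2⟩ := of_rel_f x n s (rel_mono hxn (hs.trans hr₅))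
      obtain ⟨t', ht', y₀, hy₀, h3, h4⟩ := of_rel_f y m t (rel_mono hym (ht.trans hs))
      exact ⟨t', ht'.trans ht, x₀, hx₀, y₀, hy₀, eq_mono h1 ht', eq_mono h2 ht', h3, h4⟩
    constructor
    · intro s hs hxy
      refine eq_of_dense fun s' hs' => ?_
      obtain ⟨t, ht, x₀, hx₀, y₀, hy₀, h1, h2, h3, h4⟩ := key s' (hs'.trans hs)
      obtain rfl := eq_of_elt_eq c
        (eq_trans (eq_symm h1) (eq_trans (eq_mono hxy (ht.trans hs')) h3))
      exact ⟨t, ht, eq_trans h2 (eq_symm h4)⟩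
    · intro s hs hnm
      refine eq_of_dense fun s' hs' => ?_
      obtain ⟨t, ht, x₀, hx₀, y₀, hy₀, h1, h2, h3, h4⟩ := key s' (hs'.trans hs)
      obtain rfl := hg hx₀ hy₀ (eq_of_check_ofNat
        (eq_trans (eq_symm h2) (eq_trans (eq_mono hnm (ht.trans hs')) h4)))
      exact ⟨t, ht, eq_trans h1 (eq_symm h3)⟩

end FStmt

/-! ### Splicing sequences at one index. -/

section Glue

variable {ι : Type u} [LinearOrder ι] {β : ι → Type u}

/-- The sequence that agrees with `f` below `j`, has the value `y` at `j`, and agrees with `d`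
above `j`. -/
def glue (d f : ∀ i, β i) (j : ι) (y : β j) : ∀ i, β i :=
  Function.update (fun i => if i < j then f i else d i) j y

variable (d f : ∀ i, β i) (j : ι) (y : β j)

theorem glue_of_lt {i : ι} (h : i < j) : glue d f j y i = f i := by
  simp [glue, Function.update_of_ne h.ne, h]

theorem glue_self : glue d f j y j = y := by simp [glue]

theorem glue_of_gt {i : ι} (h : j < i) : glue d f j y i = d i := by
  simp [glue, Function.update_of_ne h.ne', h.not_gt]

theorem finite_glue_ne {p : ι → Prop} (h : {i | p i ∧ f i ≠ d i}.Finite) (hp : ∀ i < j, p i) :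
    {i | glue d f j y i ≠ d i}.Finite := by
  refine (h.insert j).subset fun i hi => ?_
  rcases lt_trichotomy i j with hij | rfl | hij
  · exact .inr ⟨hp i hij, by simpa [glue_of_lt d f j y hij] using hi⟩
  · exact .inl rfl
  · exact absurd (glue_of_gt d f j y hij) hi

end Glue

/-! ### Conditions and forcing at the stages of the iteration. -/

namespace FSIteration

open FStmt

section LeBelow

variable {ι : Type u} [LinearOrder ι] {Q : ι → Type u} [∀ j, Preorder (Q j)] {a b : WithTop ι}

/-- The order of finite partial sequences below stage `a`. -/
def LeBelow (a : WithTop ι) (s t : ∀ j, WithTop (Q j)) : Prop :=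
  ∀ j : ι, (j : WithTop ι) < a → s j ≤ t j

theorem LeBelow.trans {s t v : ∀ j, WithTop (Q j)} (h : LeBelow a s t) (h' : LeBelow a t v) :
    LeBelow a s v :=
  fun j hj => _root_.le_trans (h j hj) (h' j hj)

theorem LeBelow.mono {s t : ∀ j, WithTop (Q j)} (h : LeBelow a s t) (hb : b ≤ a) : LeBelow b s t :=
  fun j hj => h j (hj.trans_le hb)

end LeBelow

variable {ι : Type u} [LinearOrder ι] [WellFoundedLT ι] (I : FSIteration ι)

/-- The restriction to stage `a` of a sequence of full length. -/
def cut (a : WithTop ι) (f : ∀ j, I.Coord j) : ∀ j : {j : ι // (j : WithTop ι) < a}, I.Coord j :=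
  fun j => f j

/-- The restriction of `f` to stage `a` is a condition. -/
def IsCond (a : WithTop ι) (f : ∀ j, I.Coord j) : Prop := I.cut a f ∈ I.Cond a

/-- The restriction of `f` to stage `a` is a condition that forces `φ`. -/
def Forces (a : WithTop ι) (f : ∀ j, I.Coord j) (φ : FStmt (I.Stage a)) : Prop :=
  ∃ h : I.IsCond a f, φ ⟨I.cut a f, h⟩

/-- The restrictions of `f` and `g` to stage `a` are conditions, the former extending the latter. -/
def Le (a : WithTop ι) (f g : ∀ j, I.Coord j) : Prop :=
  I.Forces a f fun p => ∃ h : I.IsCond a g, p ≤ ⟨I.cut a g, h⟩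

variable {I} {a b : WithTop ι} {f g k : ∀ j, I.Coord j} {j : ι}

/-- Padding with largest elements represents every condition by a sequence of full length, so that
one sequence can be restricted to all stages without casts. -/
theorem exists_eq_cut (p : I.Stage a) : ∃ f, ∃ h : I.IsCond a f, p = ⟨I.cut a f, h⟩ := by
  classical
  have : I.cut a (fun j => if h : (j : WithTop ι) < a then p.1 ⟨j, h⟩ else I.one j) = p.1 := by
    funext j
    simp [cut, j.2]
  exact ⟨_, by rw [IsCond, this]; exact p.2, Subtype.ext this.symm⟩

theorem isCond_iff : I.IsCond a f ↔ {j : ι | (j : WithTop ι) < a ∧ f j ≠ I.one j}.Finite ∧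
    ∀ j : ι, (j : WithTop ι) < a → I.Forces j f (mem (I.val j (f j)) (I.name j)) := by
  refine (I.mem_cond_iff a (I.cut a f)).trans (and_congr ?_ ?_)
  · rw [← Set.finite_image_iff Subtype.val_injective.injOn]
    apply iff_of_eq
    congr 1
    ext j
    simp [cut, and_comm]
  · exact ⟨fun h j hj => h ⟨j, hj⟩, fun h j => h j.1 j.2⟩

theorem le_iff_forces : I.Le a f g ↔ I.IsCond a f ∧ I.IsCond a g ∧ ∀ j : ι, (j : WithTop ι) < a →
    I.Forces j f (rel (I.ord j) (I.val j (f j)) (I.val j (g j))) := by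
  constructor
  · rintro ⟨hf, hg, h⟩
    exact ⟨hf, hg, fun j hj => (I.le_iff a _ _).1 h ⟨j, hj⟩⟩
  · rintro ⟨hf, hg, h⟩
    exact ⟨hf, hg, (I.le_iff a _ _).2 fun j => h j.1 j.2⟩

theorem IsCond.mono (h : I.IsCond a f) (hb : b ≤ a) : I.IsCond b f := by
  rw [isCond_iff] at h ⊢
  exact ⟨h.1.subset fun j hj => ⟨hj.1.trans_le hb, hj.2⟩, fun j hj => h.2 j (hj.trans_le hb)⟩

theorem Le.mono (h : I.Le a f g) (hb : b ≤ a) : I.Le b f g := by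
  rw [le_iff_forces] at h ⊢
  exact ⟨h.1.mono hb, h.2.1.mono hb, fun j hj => h.2.2 j (hj.trans_le hb)⟩

theorem Le.refl (h : I.IsCond a f) : I.Le a f f := ⟨h, h, le_rfl⟩

theorem Le.trans (h : I.Le a f g) (h' : I.Le a g k) : I.Le a f k := by
  obtain ⟨hf, _, h⟩ := h
  obtain ⟨_, hk, h'⟩ := h'
  exact ⟨hf, hk, _root_.le_trans h h'⟩

theorem Forces.congr {φ : FStmt (I.Stage a)} (h : I.Forces a f φ)
    (hfg : ∀ i : ι, (i : WithTop ι) < a → f i = g i) : I.Forces a g φ := by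
  have : I.cut a f = I.cut a g := funext fun i => hfg i i.2
  unfold Forces IsCond at h ⊢
  rwa [this] at h

theorem Forces.of_le {φ : FStmt (I.Stage a)} (h : I.Forces a g φ) (hfg : I.Le a f g)
    (hφ : ∀ p q, q ≤ p → φ p → φ q) : I.Forces a f φ :=
  ⟨hfg.1, hφ _ _ hfg.2.2 h.2⟩

theorem Forces.mem_of_le {x y : PName (I.Stage a)} (h : I.Forces a g (mem x y))
    (hfg : I.Le a f g) : I.Forces a f (mem x y) :=
  h.of_le hfg fun _ _ hq h => mem_mono h hq

theorem Forces.rel_of_le {r x y : PName (I.Stage a)} (h : I.Forces a g (rel r x y))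
    (hfg : I.Le a f g) : I.Forces a f (rel r x y) :=
  h.of_le hfg fun _ _ hq h => rel_mono h hq

theorem Forces.exists_le {φ : FStmt (I.Stage a)} (hf : I.IsCond a f)
    (h : ∃ r ≤ (⟨I.cut a f, hf⟩ : I.Stage a), φ r) : ∃ g, I.Le a g f ∧ I.Forces a g φ := by
  obtain ⟨r, hr, h⟩ := h
  obtain ⟨g, hg, rfl⟩ := exists_eq_cut r
  exact ⟨g, ⟨hg, hf, hr⟩, hg, h⟩

theorem forces_of_forced {φ : FStmt (I.Stage a)} (h : Forced φ) (hf : I.IsCond a f) :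
    I.Forces a f φ := ⟨hf, h _⟩

section Iterand

variable {x y z : PName (I.Stage j)}

theorem forced_one_mem (j : ι) : Forced (P := I.Stage j) (mem (I.val j (I.one j)) (I.name j)) :=
  fun p => (I.poset j p).1.1

theorem Forces.rel_one (hx : I.Forces j f (mem x (I.name j))) :
    I.Forces j f (rel (I.ord j) x (I.val j (I.one j))) :=
  ⟨hx.1, (I.poset j _).1.2 x _ le_rfl hx.2⟩

theorem Forces.rel_refl (hx : I.Forces j f (mem x (I.name j))) :
    I.Forces j f (rel (I.ord j) x x) :=
  ⟨hx.1, (I.poset j _).2.1 x _ le_rfl hx.2⟩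

theorem Forces.rel_trans (hx : I.Forces j f (mem x (I.name j)))
    (hy : I.Forces j f (mem y (I.name j))) (hz : I.Forces j f (mem z (I.name j)))
    (hxy : I.Forces j f (rel (I.ord j) x y)) (hyz : I.Forces j f (rel (I.ord j) y z)) :
    I.Forces j f (rel (I.ord j) x z) :=
  ⟨hx.1, (I.poset j _).2.2 x _ le_rfl hx.2 y _ le_rfl hy.2 z _ le_rfl hz.2 _ le_rfl hxy.2 _ le_rfl
    hyz.2⟩

theorem IsCond.forces_mem (h : I.IsCond a f) (hj : (j : WithTop ι) < a) :
    I.Forces j f (mem (I.val j (f j)) (I.name j)) :=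
  (isCond_iff.1 h).2 j hj

/-- Being a condition at stage `j` may be assumed when checking coordinate `j`, by well-founded
induction on the stage. -/
theorem isCond_of_forall (hfin : {j | f j ≠ I.one j}.Finite)
    (h : ∀ j : ι, I.IsCond j f → I.Forces j f (mem (I.val j (f j)) (I.name j))) :
    I.IsCond a f := by
  induction a using WellFoundedLT.induction with
  | ind a ih =>
    exact isCond_iff.2 ⟨hfin.subset fun j hj => hj.2, fun j hj => h j (ih j hj)⟩

variable {Q : Type u} [Preorder Q] {c : Q ↪ ZFSet.{u}}

theorem Forces.elt_mem_name (hQ : I.UsesIfCCC j c) (h : I.Forces j f (checkCCC c)) (x : Q) :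
    I.Forces j f (mem (elt _ c x) (I.name j)) :=
  ⟨h.1, mem_congr_right (eq_symm ((hQ _).1 _ le_rfl h.2).1) (elt_mem _ _ _)⟩

theorem Forces.rel_elt_iff (hQ : I.UsesIfCCC j c) (h : I.Forces j f (checkCCC c)) {x y : Q} :
    I.Forces j f (rel (I.ord j) (elt _ c x) (elt _ c y)) ↔ x ≤ y := by
  have := ((hQ _).1 _ le_rfl h.2).2 _ _ le_rfl (h.elt_mem_name hQ x).2 _ _ le_rfl
    (h.elt_mem_name hQ y).2
  exact ⟨fun h => le_of_rel_elt c (this.1 _ le_rfl h.2),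
    fun hxy => ⟨h.1, this.2 _ le_rfl (rel_elt _ hxy _)⟩⟩

theorem Forces.exists_elt (hQ : I.UsesIfCCC j c) (h : I.Forces j f (checkCCC c))
    {v : PName (I.Stage j)} (hv : I.Forces j f (mem v (I.name j))) :
    ∃ g, I.Le j g f ∧ ∃ x, I.Forces j g (eq v (elt _ c x)) := by
  obtain ⟨r, hr, x, hx⟩ := exists_elt_of_mem
    (mem_congr_right ((hQ _).1 _ le_rfl h.2).1 hv.2)
  obtain ⟨g, hg, hx⟩ := Forces.exists_le h.1 ⟨r, hr, hx⟩
  exact ⟨g, hg, x, hx⟩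

theorem Forces.rel_of_not (hQ : I.UsesIfCCC j c) (h : I.Forces j f (FStmt.not (checkCCC c)))
    (hx : I.Forces j f (mem x (I.name j))) (hy : I.Forces j f (mem y (I.name j))) :
    I.Forces j f (rel (I.ord j) x y) := by
  refine ⟨h.1, mem_of_dense fun q hq => ?_⟩
  obtain ⟨r, hr, z, -, hz⟩ := ((hQ _).2 _ le_rfl h.2) q hq
  have e := eq_trans (hz x r le_rfl (mem_mono hx.2 (hr.trans hq)))
    (eq_symm (hz y r le_rfl (mem_mono hy.2 (hr.trans hq))))
  exact ⟨r, hr, rel_congr (eq_refl _ _) e (rel_mono hx.rel_refl.2 (hr.trans hq))⟩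

theorem Forces.rel_of_eq (hx : I.Forces j f (mem x (I.name j))) (e : I.Forces j f (eq x y)) :
    I.Forces j f (rel (I.ord j) x y) ∧ I.Forces j f (rel (I.ord j) y x) :=
  ⟨⟨hx.1, rel_congr (eq_refl _ _) e.2 hx.rel_refl.2⟩,
    ⟨hx.1, rel_congr e.2 (eq_refl _ _) hx.rel_refl.2⟩⟩

end Iterand

/-! ### Decided conditions and the finite sequences they realize. -/

section Realizes

variable {Q : ι → Type u} [∀ j, Preorder (Q j)] (c : ∀ j, Q j ↪ ZFSet.{u})
  {s t : ∀ j, WithTop (Q j)}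

/-- The restriction of `f` to stage `j` forces that `Q j` is ccc and that the name `y` stands for
an element equivalent to `x`. -/
def ForcesElt (j : ι) (f : ∀ j, I.Coord j) (y : I.Coord j) (x : Q j) : Prop :=
  I.Forces j f (checkCCC (c j)) ∧ I.Forces j f (rel (I.ord j) (I.val j y) (elt _ (c j) x)) ∧
    I.Forces j f (rel (I.ord j) (elt _ (c j) x) (I.val j y))

variable {c}

theorem ForcesElt.congr {y : I.Coord j} {x : Q j} (h : ForcesElt c j f y x)
    (hfg : ∀ i : ι, (i : WithTop ι) < j → f i = g i) : ForcesElt c j g y x :=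
  ⟨h.1.congr hfg, h.2.1.congr hfg, h.2.2.congr hfg⟩

theorem Forces.checkCCC_of_le {f g : ∀ j, I.Coord j} (h : I.Forces j g (checkCCC (c j)))
    (hfg : I.Le j f g) : I.Forces j f (checkCCC (c j)) :=
  h.of_le hfg fun _ _ hq h => checkCCC_mono h hq

theorem ForcesElt.of_le {y : I.Coord j} {x : Q j} (h : ForcesElt c j g y x) (hfg : I.Le j f g) :
    ForcesElt c j f y x :=
  ⟨h.1.checkCCC_of_le hfg, h.2.1.rel_of_le hfg, h.2.2.rel_of_le hfg⟩

variable (c) in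
/-- Each coordinate of `f` below `a` is decided: it is forced to be equivalent to the largest
element where `s` is `⊤`, and to the value of `s` elsewhere, in which case the iterand is forced to
be ccc. -/
structure Realizes (a : WithTop ι) (f : ∀ j, I.Coord j) (s : ∀ j, WithTop (Q j)) : Prop where
  isCond : I.IsCond a f
  finite : {j | s j ≠ ⊤}.Finite
  top : ∀ j : ι, (j : WithTop ι) < a → s j = ⊤ →
    I.Forces j f (rel (I.ord j) (I.val j (I.one j)) (I.val j (f j)))
  coe : ∀ j : ι, (j : WithTop ι) < a → ∀ x : Q j, s j = x → ForcesElt c j f (f j) x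

theorem Realizes.mono (h : Realizes c a f s) (hb : b ≤ a) : Realizes c b f s :=
  ⟨h.isCond.mono hb, h.finite, fun j hj => h.top j (hj.trans_le hb),
    fun j hj => h.coe j (hj.trans_le hb)⟩

theorem Realizes.le (hQ : ∀ j, I.UsesIfCCC j (c j)) (hf : Realizes c a f s)
    (hg : Realizes c a g t) (hst : LeBelow a s t) : I.Le a f g := by
  induction a using WellFoundedLT.induction with
  | ind a ih =>
    refine le_iff_forces.2 ⟨hf.isCond, hg.isCond, fun j hj => ?_⟩
    have hle : I.Le j f g := ih j hj (hf.mono hj.le) (hg.mono hj.le) (hst.mono hj.le)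
    have hfm := hf.isCond.forces_mem hj
    have hgm := (hg.isCond.forces_mem hj).mem_of_le hle
    rcases ht : t j with _ | y
    · exact hfm.rel_trans (forces_of_forced (forced_one_mem j) hfm.1) hgm hfm.rel_one
        ((hg.top j hj ht).rel_of_le hle)
    · have hsj := hst j hj
      rw [ht] at hsj
      obtain ⟨x, hx, hxy⟩ := WithTop.le_coe_iff.1 hsj
      obtain ⟨h1, h2, -⟩ := hf.coe j hj x hx
      obtain ⟨-, -, h3⟩ := (hg.coe j hj y ht).of_le hle
      have hxm := h1.elt_mem_name (hQ j) x
      exact hfm.rel_trans (h1.elt_mem_name (hQ j) y) hgm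
        (hfm.rel_trans hxm (h1.elt_mem_name (hQ j) y) h2 ((h1.rel_elt_iff (hQ j)).2 hxy)) h3

/-- The order of conditions reflects to sequences only up to shrinking. Where `s j = ⊤` but `t j` is
an element, `f ≤ g` forces that element to be equivalent to the largest one, so `f` also realizes
it; `v` takes the value of `t` there. Where both are elements, the order of `Q j` is absolute. -/
theorem Realizes.exists_le_of_le (hQ : ∀ j, I.UsesIfCCC j (c j)) (hf : Realizes c a f s)
    (hg : Realizes c a g t) (hfg : I.Le a f g) :
    ∃ v, Realizes c a f v ∧ LeBelow a v s ∧ LeBelow a v t := by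
  classical
  refine ⟨fun j => if s j = ⊤ then t j else s j,
    ⟨hf.isCond, (hf.finite.union hg.finite).subset ?_, ?_, ?_⟩, ?_, ?_⟩
  · intro j hj
    by_cases h : s j = ⊤
    · exact .inr (by simpa [h] using hj)
    · exact .inl h
  · intro j hj hv
    by_cases h : s j = ⊤
    · exact hf.top j hj h
    · simp [h] at hv
  · intro j hj x hv
    by_cases h : s j = ⊤
    · simp only [h, if_true] at hv
      have hle := hfg.mono hj.le
      obtain ⟨h1, h2, h3⟩ := (hg.coe j hj x hv).of_le hle
      have hfm := hf.isCond.forces_mem hj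
      have hxm := h1.elt_mem_name (hQ j) x
      have hgm := (hg.isCond.forces_mem hj).mem_of_le hle
      exact ⟨h1, hfm.rel_trans hgm hxm ((le_iff_forces.1 hfg).2.2 j hj) h2,
        hxm.rel_trans (forces_of_forced (forced_one_mem j) hfm.1) hfm hxm.rel_one (hf.top j hj h)⟩
    · simp only [h, if_false] at hv
      exact hf.coe j hj x hv
  · intro j hj
    by_cases h : s j = ⊤ <;> simp [h]
  · intro j hj
    by_cases h : s j = ⊤
    · simp [h]
    · simp only [h, if_false]
      rcases ht : t j with _ | y
      · exact le_top
      · obtain ⟨x, hx⟩ := WithTop.ne_top_iff_exists.1 h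
        rw [← hx]
        refine WithTop.coe_le_coe.2 ?_
        have hle := hfg.mono hj.le
        obtain ⟨h1, h2, h3⟩ := hf.coe j hj x hx.symm
        obtain ⟨-, h5, -⟩ := (hg.coe j hj y ht).of_le hle
        have hfm := hf.isCond.forces_mem hj
        have hgm := (hg.isCond.forces_mem hj).mem_of_le hle
        have hxm := h1.elt_mem_name (hQ j) x
        exact (h1.rel_elt_iff (hQ j)).1 (hxm.rel_trans hgm (h1.elt_mem_name (hQ j) y)
          (hxm.rel_trans hfm hgm h3 ((le_iff_forces.1 hfg).2.2 j hj)) h5)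

theorem Realizes.glue (hf : Realizes c j f s) {y : I.Coord j} {w : WithTop (Q j)}
    (hy : I.Forces j f (mem (I.val j y) (I.name j)))
    (htop : w = ⊤ → I.Forces j f (rel (I.ord j) (I.val j (I.one j)) (I.val j y)))
    (hcoe : ∀ x : Q j, w = x → ForcesElt c j f y x) :
    Realizes c a (glue I.one f j y) (glue (fun _ => ⊤) s j w) := by
  have hlt : ∀ i ≤ j, ∀ k : ι, (k : WithTop ι) < i → f k = _root_.glue I.one f j y k :=
    fun i hi k hk => (glue_of_lt _ _ _ _ ((WithTop.coe_lt_coe.1 hk).trans_le hi)).symm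
  have hcond : I.IsCond a (_root_.glue I.one f j y) := by
    refine isCond_of_forall (finite_glue_ne _ _ _ _ (isCond_iff.1 hf.isCond).1
      fun i hi => WithTop.coe_lt_coe.2 hi) fun i hi => ?_
    rcases lt_trichotomy i j with hij | rfl | hij
    · rw [glue_of_lt _ _ _ _ hij]
      exact (hf.isCond.forces_mem (WithTop.coe_lt_coe.2 hij)).congr (hlt i hij.le)
    · rw [glue_self]
      exact hy.congr (hlt i le_rfl)
    · rw [glue_of_gt _ _ _ _ hij]
      exact forces_of_forced (forced_one_mem i) hi
  refine ⟨hcond, finite_glue_ne (p := fun _ => True) _ _ _ _ (by simpa using hf.finite) (by simp),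
    fun i hi hs => ?_, fun i hi x hx => ?_⟩
  · rcases lt_trichotomy i j with hij | rfl | hij
    · rw [glue_of_lt _ _ _ _ hij] at hs ⊢
      exact (hf.top i (WithTop.coe_lt_coe.2 hij) hs).congr (hlt i hij.le)
    · rw [glue_self] at hs ⊢
      exact (htop hs).congr (hlt i le_rfl)
    · rw [glue_of_gt _ _ _ _ hij]
      exact (forces_of_forced (forced_one_mem i) (hcond.mono hi.le)).rel_refl
  · rcases lt_trichotomy i j with hij | rfl | hij
    · rw [glue_of_lt _ _ _ _ hij] at hx ⊢
      exact (hf.coe i (WithTop.coe_lt_coe.2 hij) x hx).congr (hlt i hij.le)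
    · rw [glue_self] at hx ⊢
      exact (hcoe x hx).congr (hlt i le_rfl)
    · rw [glue_of_gt _ _ _ _ hij] at hx
      exact absurd hx WithTop.top_ne_coe

theorem realizes_of_eq_one (hf : ∀ j : ι, (j : WithTop ι) < a → f j = I.one j)
    (hc : I.IsCond a f) : Realizes c a f (fun _ => ⊤) :=
  ⟨hc, by simp, fun j hj _ => by
      rw [hf j hj]
      exact (forces_of_forced (forced_one_mem j) (hc.mono hj.le)).rel_refl,
    fun j _ x h => absurd h WithTop.top_ne_coe⟩

/-- Either some extension forces `Q j` to be ccc, and a further one decides `y` as an element of `Q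
j`; or `f` already forces the contrary, the iterand has one element, and `⊤` describes `y`. -/
theorem exists_decided (hQ : ∀ j, I.UsesIfCCC j (c j)) {y : I.Coord j}
    (hy : I.Forces j f (mem (I.val j y) (I.name j))) :
    ∃ g, I.Le j g f ∧ ∃ w : WithTop (Q j),
      (w = ⊤ → I.Forces j g (rel (I.ord j) (I.val j (I.one j)) (I.val j y))) ∧
      ∀ x : Q j, w = x → ForcesElt c j g y x := by
  by_cases h : ∃ r ≤ (⟨I.cut j f, hy.1⟩ : I.Stage j), checkCCC (c j) r
  · obtain ⟨g, hg, h⟩ := Forces.exists_le hy.1 h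
    obtain ⟨k, hk, x, hx⟩ := h.exists_elt (hQ j) (hy.mem_of_le hg)
    refine ⟨k, hk.trans hg, x, fun h => absurd h WithTop.coe_ne_top, fun x' hx' => ?_⟩
    obtain rfl := WithTop.coe_injective hx'
    exact ⟨h.checkCCC_of_le hk, (hy.mem_of_le (hk.trans hg)).rel_of_eq hx⟩
  · push Not at h
    exact ⟨f, .refl hy.1, ⊤, fun _ => Forces.rel_of_not (hQ j) ⟨hy.1, h⟩
      (forces_of_forced (forced_one_mem j) hy.1) hy, fun x hx => absurd hx WithTop.top_ne_coe⟩

/-- The realized conditions are dense. -/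
theorem exists_realizes_le (hQ : ∀ j, I.UsesIfCCC j (c j)) (hf : I.IsCond a f) :
    ∃ g s, Realizes c a g s ∧ I.Le a g f := by
  induction a using WellFoundedLT.induction generalizing f with
  | ind a ih =>
    obtain hemp | hne := {j : ι | (j : WithTop ι) < a ∧ f j ≠ I.one j}.eq_empty_or_nonempty
    · refine ⟨f, _, realizes_of_eq_one (fun j hj => ?_) hf, .refl hf⟩
      by_contra h
      exact (Set.eq_empty_iff_forall_notMem.1 hemp j) ⟨hj, h⟩
    · obtain ⟨j, ⟨hj, -⟩, hmax⟩ := Set.exists_max_image _ id (isCond_iff.1 hf).1 hne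
      have hm := hf.forces_mem hj
      -- The last nontrivial coordinate is decided before the induction hypothesis is applied below
      -- it, so that the realized condition inherits the decision.
      obtain ⟨f', hf', w, htop, hcoe⟩ := exists_decided hQ hm
      obtain ⟨g, s, hg, hgf⟩ := ih j hj hf'.1
      have hr : Realizes c a _ _ := hg.glue (hm.mem_of_le (hgf.trans hf'))
        (fun h => (htop h).rel_of_le hgf) (fun x hx => (hcoe x hx).of_le hgf)
      refine ⟨_, _, hr, le_iff_forces.2 ⟨hr.isCond, hf, fun i hi => ?_⟩⟩
      have hrefl := (hr.isCond.forces_mem hi).rel_refl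
      rcases lt_trichotomy i j with hij | rfl | hij
      · rw [glue_of_lt _ _ _ _ hij]
        exact ((le_iff_forces.1 (hgf.trans hf')).2.2 i (WithTop.coe_lt_coe.2 hij)).congr
          fun k hk => (glue_of_lt _ _ _ _ ((WithTop.coe_lt_coe.1 hk).trans hij)).symm
      · rw [glue_self] at hrefl ⊢
        exact hrefl
      · rw [glue_of_gt _ _ _ _ hij] at hrefl ⊢
        have : f i = I.one i := by
          by_contra h
          exact hij.not_ge (hmax i ⟨hi, h⟩)
        rwa [this]

variable (I c) in
/-- All realized conditions below `s` force that `Q j` is ccc. -/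
def Good (j : ι) (s : ∀ j, WithTop (Q j)) : Prop :=
  ∀ f t, Realizes (I := I) c j f t → LeBelow j t s → I.Forces j f (checkCCC (c j))

variable (I c) in
/-- The finite partial sequences that represent conditions of stage `a`. -/
def Admissible (a : WithTop ι) (s : ∀ j, WithTop (Q j)) : Prop :=
  {j | s j ≠ ⊤}.Finite ∧ ∀ j : ι, (j : WithTop ι) < a → s j ≠ ⊤ → Good I c j s

theorem Good.mono (h : Good I c j t) (hst : LeBelow j s t) : Good I c j s :=
  fun f v hf hv => h f v hf (hv.trans hst)

theorem Admissible.mono (h : Admissible I c a s) (hb : b ≤ a) : Admissible I c b s :=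
  ⟨h.1, fun j hj => h.2 j (hj.trans_le hb)⟩

theorem Realizes.admissible (hQ : ∀ j, I.UsesIfCCC j (c j)) (hf : Realizes c a f s) :
    Admissible I c a s := by
  refine ⟨hf.finite, fun j hj hs g t hg ht => ?_⟩
  obtain ⟨x, hx⟩ := WithTop.ne_top_iff_exists.1 hs
  exact (hf.coe j hj x hx.symm).1.checkCCC_of_le (hg.le hQ (hf.mono hj.le) ht)

/-- Induction along the support: what is realized below the last index `j` of the support forces `Q
j` to be ccc by goodness, so the prescribed element belongs to the iterand and, after an extension,
is named by some coordinate. -/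
theorem Admissible.exists_realizes (hQ : ∀ j, I.UsesIfCCC j (c j)) (hs : Admissible I c a s) :
    ∃ f t, Realizes (I := I) c a f t ∧ LeBelow a t s := by
  induction a using WellFoundedLT.induction with
  | ind a ih =>
    obtain hemp | hne := {j : ι | (j : WithTop ι) < a ∧ s j ≠ ⊤}.eq_empty_or_nonempty
    · refine ⟨I.one, _, realizes_of_eq_one (fun _ _ => rfl)
        (isCond_of_forall (by simp) fun j hj => forces_of_forced (forced_one_mem j) hj),
        fun j hj => ?_⟩
      by_contra h
      exact (Set.eq_empty_iff_forall_notMem.1 hemp j) ⟨hj, fun h' => h (by simp [h'])⟩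
    · obtain ⟨j, ⟨hj, hsj⟩, hmax⟩ := Set.exists_max_image _ id
        (hs.1.subset fun j (hj : (j : WithTop ι) < a ∧ s j ≠ ⊤) => hj.2) hne
      obtain ⟨f, t, hf, ht⟩ := ih j hj (hs.mono hj.le)
      have hccc := hs.2 j hj hsj f t hf ht
      obtain ⟨x, hx⟩ := WithTop.ne_top_iff_exists.1 hsj
      have hxm := hccc.elt_mem_name (hQ j) x
      obtain ⟨q, hq, y, hy⟩ := I.exhaust j _ _ _ le_rfl hxm.2 _ le_rfl
      obtain ⟨f', hf', hy⟩ := Forces.exists_le hccc.1 ⟨q, hq, hy⟩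
      obtain ⟨g, t', hg, hgf⟩ := exists_realizes_le hQ hf'.1
      -- `g` extends `f` as a condition, but `t'` need not lie below `t`; the sequence is shrunk
      -- accordingly.
      obtain ⟨v, hv, -, hvt⟩ := hg.exists_le_of_le hQ hf (hgf.trans hf')
      have hgf' := hgf.trans hf'
      have hy : I.Forces j g (eq (elt _ (c j) x) (I.val j y)) :=
        hy.of_le hgf fun _ _ hq h => eq_mono h hq
      have hxm := hxm.mem_of_le hgf'
      have hr : Realizes c a _ _ := hv.glue (y := y) (w := x) ⟨hxm.1, mem_congr_left hy.2 hxm.2⟩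
        (fun h => absurd h WithTop.coe_ne_top) fun x' hx' => by
          obtain rfl := WithTop.coe_injective hx'
          exact ⟨hccc.checkCCC_of_le hgf', (hxm.rel_of_eq hy).2, (hxm.rel_of_eq hy).1⟩
      refine ⟨_, _, hr, fun i hi => ?_⟩
      rcases lt_trichotomy i j with hij | rfl | hij
      · rw [glue_of_lt _ _ _ _ hij]
        exact hvt.trans ht i (WithTop.coe_lt_coe.2 hij)
      · rw [glue_self, hx]
      · have : s i = ⊤ := by
          by_contra h
          exact hij.not_ge (hmax i ⟨hi, h⟩)
        rw [this]
        exact le_top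

end Realizes

end FSIteration

/-! ### Independence of the first coordinate. -/

namespace FSIteration

open FStmt Function

variable {ι : Type u} [LinearOrder ι] [WellFoundedLT ι] {I : FSIteration ι}
  {Q : ι → Type u} [∀ j, Preorder (Q j)] {c : ∀ j, Q j ↪ ZFSet.{u}}

theorem Realizes.exists_of_compat (hQ : ∀ j, I.UsesIfCCC j (c j)) {a : WithTop ι}
    {f g : ∀ j, I.Coord j} {s t : ∀ j, WithTop (Q j)} (hf : Realizes c a f s)
    (hg : Realizes c a g t)
    (h : Compat (⟨I.cut a f, hf.isCond⟩ : I.Stage a) ⟨I.cut a g, hg.isCond⟩) :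
    ∃ k v, Realizes c a k v ∧ I.Le a k f ∧ I.Le a k g ∧ LeBelow a v s ∧ LeBelow a v t := by
  obtain ⟨p, hpf, hpg⟩ := h
  obtain ⟨k, hk, rfl⟩ := exists_eq_cut p
  obtain ⟨l, v, hl, hlk⟩ := exists_realizes_le hQ hk
  have hlf : I.Le a l f := hlk.trans ⟨hk, hf.isCond, hpf⟩
  have hlg : I.Le a l g := hlk.trans ⟨hk, hg.isCond, hpg⟩
  obtain ⟨v₁, h₁, -, hs⟩ := hl.exists_le_of_le hQ hf hlf
  obtain ⟨v₂, h₂, h₂₁, ht⟩ := h₁.exists_le_of_le hQ hg hlg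
  exact ⟨l, v₂, h₂, hlf, hlg, h₂₁.trans hs, ht⟩

theorem isCond_one (a : WithTop ι) : I.IsCond a I.one :=
  isCond_of_forall (by simp) fun j hj => forces_of_forced (forced_one_mem j) hj

variable [OrderBot ι]

/-- Stage `⊥` has only the empty condition, so an antichain of its product with `Q ⊥` is essentially
one of `Q ⊥`, and transfers to `P × Q ⊥` with a trivial first component. -/
theorem forces_bot (hprod : IsCCC (I.Stage ⊤ × Q ⊥)) {f : ∀ j, I.Coord j}
    (hf : I.IsCond (⊥ : ι) f) : I.Forces (⊥ : ι) f (checkCCC (c ⊥)) := by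
  refine ⟨hf, checkCCC_of_countable (c ⊥) fun A _ hA => ?_⟩
  refine hprod.countable_of_family (fun i => (⟨I.cut ⊤ I.one, isCond_one ⊤⟩, i.2)) ?_
  rintro i hi j hj hij ⟨⟨_, z⟩, ⟨-, hz⟩, ⟨-, hz'⟩⟩
  have : i.1 = j.1 := Subtype.ext (funext fun k => absurd (WithTop.coe_lt_coe.1 k.2) not_lt_bot)
  exact hA i hi j hj hij ⟨(i.1, z), ⟨le_rfl, hz⟩, ⟨this.le, hz'⟩⟩

theorem nonempty_bot (hQ : ∀ j, I.UsesIfCCC j (c j)) (hprod : IsCCC (I.Stage ⊤ × Q ⊥)) :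
    Nonempty (Q ⊥) := by
  have h := forces_bot (c := c) hprod (isCond_one (I := I) _)
  obtain ⟨-, -, x, -⟩ := h.exists_elt (hQ ⊥) (forces_of_forced (forced_one_mem ⊥) h.1)
  exact ⟨x⟩

/-- Independence is assumed only below `a`, so that this applies inside the induction proving it. -/
theorem Admissible.update_of_good {a : WithTop ι} {s : ∀ j, WithTop (Q j)}
    (hs : Admissible I c a s) (w : WithTop (Q ⊥)) (hbot : ∀ s, Good I c ⊥ s)
    (h : ∀ j : ι, (j : WithTop ι) < a → ∀ s, Good I c j s → Good I c j (update s ⊥ w)) :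
    Admissible I c a (update s ⊥ w) := by
  refine ⟨(hs.1.insert ⊥).subset fun j hj => ?_, fun j hj hne => ?_⟩
  · by_cases hb : j = ⊥
    · exact .inl hb
    · exact .inr (by simpa [update_of_ne hb] using hj)
  · by_cases hb : j = ⊥
    · subst hb
      exact hbot _
    · rw [update_of_ne hb] at hne
      exact h j hj s (hs.2 j hj hne)

/-- Whether `Q j` is forced to be ccc does not depend on the first coordinate. -/
theorem Good.update (hQ : ∀ j, I.UsesIfCCC j (c j)) (hprod : IsCCC (I.Stage ⊤ × Q ⊥)) (j : ι)
    (s : ∀ j, WithTop (Q j)) (w : WithTop (Q ⊥)) (hs : Good I c j s) :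
    Good I c j (update s ⊥ w) := by
  have hbot : ∀ s, Good I c ⊥ s := fun s f t hf _ => forces_bot hprod hf.isCond
  obtain ⟨q₀⟩ := nonempty_bot hQ hprod
  induction j using WellFoundedLT.induction generalizing s w with
  | ind j ih =>
    obtain rfl | hj := eq_or_ne j ⊥
    · exact hbot _
    have ih' : ∀ i : ι, (i : WithTop ι) < j → ∀ s w, Good I c i s →
        Good I c i (Function.update s ⊥ w) :=
      fun i hi => ih i (WithTop.coe_lt_coe.1 hi)
    intro f t hf ht
    refine ⟨hf.isCond, checkCCC_of_countable (c j) fun A hAf hA => ?_⟩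
    -- For `(p, y)` in `A`, `v` is realized below `p`. Its first coordinate is exchanged for `s ⊥`,
    -- which puts it below `s`, and `y` is appended at `j`, which is admissible since `s` is good.
    -- The result is realized by `r`, while `z` records the first coordinate given up.
    have key : ∀ i : A, ∃ g v, ∃ hg : Realizes (I := I) c j g v, ∃ r u, Realizes (I := I) c ⊤ r u ∧
        ∃ z : Q ⊥, (⟨I.cut j g, hg.isCond⟩ : I.Stage j) ≤ i.1.1 ∧
        LeBelow ⊤ u (glue (fun _ => ⊤) (Function.update v ⊥ (s ⊥)) j i.1.2) ∧ z ≤ v ⊥ := by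
      rintro ⟨⟨p, y⟩, hi⟩
      obtain ⟨k, hk, rfl⟩ := exists_eq_cut p
      obtain ⟨g, v, hg, hgk⟩ := exists_realizes_le hQ hk
      have hgf : I.Le j g f := hgk.trans ⟨hk, hf.isCond, hAf _ hi⟩
      obtain ⟨v, hv, -, hvt⟩ := hg.exists_le_of_le hQ hf hgf
      have hadm := (hv.admissible hQ).update_of_good (s ⊥) hbot fun i hi s => ih' i hi s _
      have hle : LeBelow j (Function.update v ⊥ (s ⊥)) s := by
        intro i hi
        by_cases hb : i = ⊥
        · subst hb
          simp
        · have := hvt.trans ht i hi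
          simpa [update_of_ne hb] using this
      have hadm' : Admissible I c ⊤
          (glue (fun _ => ⊤) (Function.update v ⊥ (s ⊥)) j (y : WithTop (Q j))) := by
        refine ⟨finite_glue_ne (p := fun _ => True) _ _ _ _ (by simpa using hadm.1) (by simp),
          fun i _ hi => ?_⟩
        have hglue : ∀ i ≤ j, LeBelow (i : WithTop ι)
            (glue (fun _ => ⊤) (Function.update v ⊥ (s ⊥)) j (y : WithTop (Q j)))
            (Function.update v ⊥ (s ⊥)) :=
          fun i hi k hk => (glue_of_lt _ _ _ _ ((WithTop.coe_lt_coe.1 hk).trans_le hi)).le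
        rcases lt_trichotomy i j with hij | rfl | hij
        · rw [glue_of_lt _ _ _ _ hij] at hi
          exact (hadm.2 i (WithTop.coe_lt_coe.2 hij) hi).mono (hglue i hij.le)
        · exact hs.mono ((hglue i le_rfl).trans hle)
        · exact absurd (glue_of_gt _ _ _ _ hij) hi
      obtain ⟨r, u, hr, hu⟩ := hadm'.exists_realizes hQ
      -- If `v ⊥ = ⊤`, any element of `Q ⊥` may be recorded, since only `z ≤ v ⊥` is needed.
      refine ⟨g, v, hv, r, u, hr, (v ⊥).untopD q₀, ?_, hu, ?_⟩
      · obtain ⟨_, _, h⟩ := hgk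
        exact h
      · cases v ⊥ <;> simp
    choose g v hg r u hr z hgi hu hz using key
    rw [← Set.countable_coe_iff, ← Set.countable_univ_iff]
    refine hprod.countable_of_family (fun i => (⟨I.cut ⊤ (r i), (hr i).isCond⟩, z i)) ?_
    rintro i - k - hik ⟨⟨p, z'⟩, ⟨hpi, hzi⟩, ⟨hpk, hzk⟩⟩
    obtain ⟨l, u', hl, -, -, hui, huk⟩ := (hr i).exists_of_compat hQ (hr k) ⟨p, hpi, hpk⟩
    -- The exchange is reversed: with the common lower bound `z'` as first coordinate, the part of
    -- `u'` below `j` lies below both recorded sequences `v`, and `u' j` lies below both second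
    -- components.
    have hadm := ((hl.mono le_top).admissible hQ).update_of_good (z' : WithTop (Q ⊥)) hbot
      fun i hi s => ih' i hi s _
    obtain ⟨l', t', hl', ht'⟩ := hadm.exists_realizes hQ
    have hcoord : ∀ i, LeBelow ⊤ u' (u i) → ∃ y, u' j = WithTop.some y ∧ y ≤ i.1.2 := by
      intro i hi
      have := (hi.trans (hu i)) j (WithTop.coe_lt_top j)
      rw [glue_self] at this
      exact WithTop.le_coe_iff.1 this
    have hext : ∀ i, LeBelow ⊤ u' (u i) → z' ≤ z i →
        (⟨I.cut j l', hl'.isCond⟩ : I.Stage j) ≤ i.1.1 := by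
      intro i hi hzi
      obtain ⟨_, _, h⟩ := hl'.le hQ (hg i) (ht'.trans fun n hn => by
        by_cases hb : n = ⊥
        · subst hb
          rw [update_self]
          exact (WithTop.coe_le_coe.2 hzi).trans (hz i)
        · have := (hi.trans (hu i)) n (WithTop.coe_lt_top n)
          rw [glue_of_lt _ _ _ _ (WithTop.coe_lt_coe.1 hn)] at this
          simpa [update_of_ne hb] using this)
      exact h.trans (hgi i)
    obtain ⟨y, hy, hyi⟩ := hcoord i hui
    obtain ⟨y', hy', hyk⟩ := hcoord k huk
    obtain rfl := WithTop.coe_injective (hy.symm.trans hy')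
    exact hA i.1 i.2 k.1 k.2 (fun h => hik (Subtype.ext h))
      ⟨(_, y), ⟨hext i hui hzi, hyi⟩, ⟨hext k huk hzk, hyk⟩⟩

theorem Admissible.update (hQ : ∀ j, I.UsesIfCCC j (c j)) (hprod : IsCCC (I.Stage ⊤ × Q ⊥))
    {a : WithTop ι} {s : ∀ j, WithTop (Q j)} (hs : Admissible I c a s) (w : WithTop (Q ⊥)) :
    Admissible I c a (update s ⊥ w) :=
  hs.update_of_good w (fun _ _ _ hf _ => forces_bot hprod hf.isCond)
    fun j _ s => Good.update hQ hprod j s w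

end FSIteration

/-! ### From a common dense source to a common target. -/

theorem IsDenseOrderEmbedding.comp {P Q R : Type u} [Preorder P] [Preorder Q] [Preorder R]
    {f : Q → R} {e : P → Q} (hf : IsDenseOrderEmbedding f) (he : IsDenseOrderEmbedding e) :
    IsDenseOrderEmbedding (f ∘ e) where
  mono p q h := hf.mono _ _ (he.mono _ _ h)
  incompat p q h := hf.incompat _ _ (he.incompat _ _ h)
  dense r := by
    obtain ⟨q, hq⟩ := hf.dense r
    obtain ⟨p, hp⟩ := he.dense q
    exact ⟨p, (hf.mono _ _ hp).trans hq⟩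

theorem isDenseOrderEmbedding_prodMap_toAntisymmetrization (Q S : Type u) [Preorder Q]
    [Preorder S] : IsDenseOrderEmbedding
      (Prod.map id (toAntisymmetrization (· ≤ ·)) : Q × S → Q × Antisymmetrization S (· ≤ ·)) where
  mono _ _ h := ⟨h.1, h.2⟩
  incompat p q h := by
    rintro ⟨⟨x, s⟩, ⟨h1, h2⟩, ⟨h3, h4⟩⟩
    induction s using Quotient.inductionOn with
    | h s => exact h ⟨(x, s), ⟨h1, h2⟩, ⟨h3, h4⟩⟩
  dense := by
    rintro ⟨x, s⟩
    induction s using Quotient.inductionOn with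
    | h s => exact ⟨(x, s), le_rfl, le_rfl⟩

/-- The nonempty regular open sets of a poset. -/
abbrev RegularOpen (E : Type u) [Preorder E] : Type u :=
  {U : Set E // U.Nonempty ∧ IsLowerSet U ∧ ∀ d, (∀ d' ≤ d, ∃ d'' ≤ d', d'' ∈ U) → d ∈ U}

/-- The condition `p` goes to the set of those `d` all of whose extensions have image compatible
with `p`. The target depends on `E` alone, so two posets with dense embeddings from `E` share it. -/
theorem IsDenseOrderEmbedding.exists_regularOpen {E P : Type u} [Preorder E] [Preorder P]
    {i : E → P} (hi : IsDenseOrderEmbedding i) :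
    ∃ e : P → RegularOpen E, IsDenseOrderEmbedding e := by
  refine ⟨fun p => ⟨{d | ∀ d' ≤ d, Compat (i d') p}, ?_, ?_, ?_⟩, ⟨?_, ?_, ?_⟩⟩
  · obtain ⟨d, hd⟩ := hi.dense p
    exact ⟨d, fun d' hd' => ⟨i d', le_rfl, (hi.mono _ _ hd').trans hd⟩⟩
  · exact fun d d' hd' h d'' hd'' => h d'' (hd''.trans hd')
  · intro d h d' hd'
    obtain ⟨d₂, h₂, h⟩ := h d' hd'
    obtain ⟨r, hr, hrp⟩ := h d₂ le_rfl
    exact ⟨r, hr.trans (hi.mono _ _ h₂), hrp⟩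
  · intro p q hpq d hd d' hd'
    obtain ⟨r, hr, hrp⟩ := hd d' hd'
    exact ⟨r, hr, hrp.trans hpq⟩
  · rintro p q hpq ⟨⟨U, ⟨d, hd⟩, _⟩, hUp, hUq⟩
    obtain ⟨r, hrd, hrp⟩ := hUp hd d le_rfl
    obtain ⟨d₁, hd₁⟩ := hi.dense r
    have hc : Compat d₁ d := by
      by_contra h
      exact hi.incompat _ _ h ⟨i d₁, le_rfl, hd₁.trans hrd⟩
    obtain ⟨d₂, h₂₁, h₂⟩ := hc
    obtain ⟨r', hr', hq⟩ := hUq hd d₂ h₂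
    exact hpq ⟨r', hr'.trans ((hi.mono _ _ h₂₁).trans (hd₁.trans hrp)), hq⟩
  · rintro ⟨U, ⟨d, hd⟩, hlow, hreg⟩
    refine ⟨i d, fun d₀ h₀ => hreg d₀ fun d' hd' => ?_⟩
    have hc : Compat d' d := by
      by_contra h
      exact hi.incompat _ _ h (h₀ d' hd')
    obtain ⟨d₂, h₁, h₂⟩ := hc
    exact ⟨d₂, h₁, hlow h₂ hd⟩

theorem forcingEquiv_of_isDenseOrderEmbedding {E P Q : Type u} [Preorder E] [Preorder P]
    [Preorder Q] {i : E → P} {k : E → Q} (hi : IsDenseOrderEmbedding i)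
    (hk : IsDenseOrderEmbedding k) : ForcingEquiv P Q := by
  obtain ⟨e, he⟩ := hi.exists_regularOpen
  obtain ⟨f, hf⟩ := hk.exists_regularOpen
  exact ⟨RegularOpen E, inferInstance, e, f, he, hf⟩

/-! ### Splitting off the first coordinate. -/

namespace FSIteration

open FStmt Function

theorem update_le_update_iff_of_bot_eq_top {ι : Type u} [LinearOrder ι] [OrderBot ι]
    {Q : ι → Type u} [∀ j, Preorder (Q j)] {s t : ∀ j, WithTop (Q j)} (hs : s ⊥ = ⊤)
    (ht : t ⊥ = ⊤) {x y : Q ⊥} :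
    LeBelow ⊤ (update s ⊥ (x : WithTop (Q ⊥))) (update t ⊥ (y : WithTop (Q ⊥))) ↔
      x ≤ y ∧ s ≤ t := by
  constructor
  · intro h
    refine ⟨by simpa using h ⊥ (WithTop.coe_lt_top _), fun j => ?_⟩
    by_cases hb : j = ⊥
    · subst hb
      rw [hs, ht]
    · simpa [update_of_ne hb] using h j (WithTop.coe_lt_top _)
  · rintro ⟨h1, h2⟩ j -
    by_cases hb : j = ⊥
    · subst hb
      simpa using h1
    · simpa [update_of_ne hb] using h2 j

variable {ι : Type u} [LinearOrder ι] [WellFoundedLT ι] [OrderBot ι] (I : FSIteration ι)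
  {Q : ι → Type u} [∀ j, Preorder (Q j)] (c : ∀ j, Q j ↪ ZFSet.{u})

/-- The finite partial sequences that represent conditions with trivial first coordinate. -/
abbrev Tail : Type u := {s : ∀ j, WithTop (Q j) // Admissible I c ⊤ s ∧ s ⊥ = ⊤}

/-- The conditions `p` of the iteration, together with a pair that `p` realizes. -/
abbrev Realization : Type u :=
  {e : I.Stage ⊤ × (Q ⊥ × Tail I c) //
    ∃ f, ∃ h : I.IsCond ⊤ f, e.1 = ⟨I.cut ⊤ f, h⟩ ∧
      Realizes c ⊤ f (update e.2.2.1 ⊥ (e.2.1 : WithTop (Q ⊥)))}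

variable {I c}

theorem exists_realization (hQ : ∀ j, I.UsesIfCCC j (c j)) (hprod : IsCCC (I.Stage ⊤ × Q ⊥))
    {f : ∀ j, I.Coord j} {s : ∀ j, WithTop (Q j)} (hf : Realizes c ⊤ f s) {x : Q ⊥}
    (hx : s ⊥ = x) : ∃ e : Realization I c, e.1.1 = ⟨I.cut ⊤ f, hf.isCond⟩ ∧ e.1.2.1 = x ∧
      update e.1.2.2.1 ⊥ (x : WithTop (Q ⊥)) = s := by
  have h : update (update s ⊥ ⊤) ⊥ (x : WithTop (Q ⊥)) = s := by
    rw [update_idem, ← hx, update_eq_self]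
  exact ⟨⟨(⟨I.cut ⊤ f, hf.isCond⟩, (x, ⟨update s ⊥ ⊤,
    (hf.admissible hQ).update hQ hprod ⊤, update_self _ _ _⟩)), f, hf.isCond, rfl, by rwa [h]⟩,
    rfl, rfl, h⟩

/-- A first coordinate `⊤` must first be lowered to an element of `Q ⊥`; independence of the first
coordinate keeps the sequence admissible. -/
theorem exists_realization_of_admissible (hQ : ∀ j, I.UsesIfCCC j (c j))
    (hprod : IsCCC (I.Stage ⊤ × Q ⊥)) {s : ∀ j, WithTop (Q j)} (hs : Admissible I c ⊤ s) :
    ∃ f, ∃ h : I.IsCond ⊤ f, ∃ e : Realization I c, e.1.1 = ⟨I.cut ⊤ f, h⟩ ∧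
      Realizes c ⊤ f (update e.1.2.2.1 ⊥ (e.1.2.1 : WithTop (Q ⊥))) ∧
      LeBelow ⊤ (update e.1.2.2.1 ⊥ (e.1.2.1 : WithTop (Q ⊥))) s := by
  obtain ⟨q₀⟩ := nonempty_bot hQ hprod
  obtain ⟨x, hx⟩ : ∃ x : Q ⊥, (x : WithTop (Q ⊥)) ≤ s ⊥ := by
    rcases s ⊥ with _ | x
    · exact ⟨q₀, le_top⟩
    · exact ⟨x, le_rfl⟩
  obtain ⟨f, t, hf, ht⟩ := (hs.update hQ hprod (x : WithTop (Q ⊥))).exists_realizes hQ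
  have htx := ht ⊥ (WithTop.coe_lt_top _)
  rw [update_self] at htx
  obtain ⟨y, hy, -⟩ := WithTop.le_coe_iff.1 htx
  obtain ⟨e, he, rfl, hes⟩ := exists_realization hQ hprod hf hy
  refine ⟨f, hf.isCond, e, he, by rwa [hes], ?_⟩
  rw [hes]
  refine ht.trans fun j _ => ?_
  by_cases hb : j = ⊥
  · subst hb
    simpa using hx
  · simp [update_of_ne hb]

theorem isDenseOrderEmbedding_fst (hQ : ∀ j, I.UsesIfCCC j (c j))
    (hprod : IsCCC (I.Stage ⊤ × Q ⊥)) :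
    IsDenseOrderEmbedding (fun e : Realization I c => e.1.1) where
  mono _ _ h := h.1
  incompat := by
    intro e₁ e₂ hpq hc
    obtain ⟨f, h₁, he₁, hf⟩ := e₁.2
    obtain ⟨g, h₂, he₂, hg⟩ := e₂.2
    rw [he₁, he₂] at hc
    obtain ⟨k, v, hk, hkf, hkg, hvs, hvt⟩ := hf.exists_of_compat hQ hg hc
    have hx := hvs ⊥ (WithTop.coe_lt_top _)
    rw [update_self] at hx
    obtain ⟨z, hz, -⟩ := WithTop.le_coe_iff.1 hx
    obtain ⟨e, he, rfl, rfl⟩ := exists_realization hQ hprod hk hz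
    refine hpq ⟨e, ⟨?_, ?_⟩, ⟨?_, ?_⟩⟩
    · exact (he.le.trans hkf.2.2).trans he₁.ge
    · exact (update_le_update_iff_of_bot_eq_top e.1.2.2.2.2 e₁.1.2.2.2.2).1 hvs
    · exact (he.le.trans hkg.2.2).trans he₂.ge
    · exact (update_le_update_iff_of_bot_eq_top e.1.2.2.2.2 e₂.1.2.2.2.2).1 hvt
  dense p := by
    obtain ⟨f, hf, rfl⟩ := exists_eq_cut p
    obtain ⟨g, s, hg, hgf⟩ := exists_realizes_le hQ hf
    obtain ⟨k, hk, e, he, hr, hle⟩ := exists_realization_of_admissible hQ hprod (hg.admissible hQ)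
    exact ⟨e, he.le.trans ((hr.le hQ hg hle).trans hgf).2.2⟩

/-- A common lower bound in the product is recombined into one admissible sequence by inserting its
first component at `⊥`; what realizes a refinement of it extends both conditions. -/
theorem isDenseOrderEmbedding_snd (hQ : ∀ j, I.UsesIfCCC j (c j))
    (hprod : IsCCC (I.Stage ⊤ × Q ⊥)) :
    IsDenseOrderEmbedding (fun e : Realization I c => e.1.2) where
  mono _ _ h := h.2
  incompat := by
    rintro e₁ e₂ hpq ⟨⟨z, v⟩, hv, hv'⟩
    obtain ⟨f, h₁, he₁, hf⟩ := e₁.2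
    obtain ⟨g, h₂, he₂, hg⟩ := e₂.2
    obtain ⟨k, hk, e, he, hr, hle⟩ := exists_realization_of_admissible hQ hprod
      (v.2.1.update hQ hprod (z : WithTop (Q ⊥)))
    have hs := hle.trans ((update_le_update_iff_of_bot_eq_top v.2.2 e₁.1.2.2.2.2).2 hv)
    have ht := hle.trans ((update_le_update_iff_of_bot_eq_top v.2.2 e₂.1.2.2.2.2).2 hv')
    refine hpq ⟨e, ⟨?_, ?_⟩, ⟨?_, ?_⟩⟩
    · exact (he.le.trans (hr.le hQ hf hs).2.2).trans he₁.ge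
    · exact (update_le_update_iff_of_bot_eq_top e.1.2.2.2.2 e₁.1.2.2.2.2).1 hs
    · exact (he.le.trans (hr.le hQ hg ht).2.2).trans he₂.ge
    · exact (update_le_update_iff_of_bot_eq_top e.1.2.2.2.2 e₂.1.2.2.2.2).1 ht
  dense := by
    rintro ⟨x, s⟩
    obtain ⟨k, hk, e, he, hr, hle⟩ := exists_realization_of_admissible hQ hprod
      (s.2.1.update hQ hprod (x : WithTop (Q ⊥)))
    exact ⟨e, (update_le_update_iff_of_bot_eq_top e.1.2.2.2.2 s.2.2).1 hle⟩

instance : OrderTop (Tail I c) where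
  top := ⟨fun _ => ⊤, ⟨by simp, fun _ _ h => absurd rfl h⟩, rfl⟩
  le_top _ _ := le_top

end FSIteration

theorem mainTheorem12 {ι : Type u} [LinearOrder ι] [WellFoundedLT ι] [OrderBot ι]
    (I : FSIteration ι) (hI : IsCCC (I.Stage ⊤))
    (Q : ι → Type u) [∀ j, Preorder (Q j)] (c : ∀ j, Q j ↪ ZFSet.{u})
    (hQ : ∀ j, I.UsesIfCCC j (c j))
    (hQ₀ : Forced (P := I.Stage ⊤) (FStmt.checkCCC (c ⊥))) :
    ∃ (Pbar : Type u) (_ : PartialOrder Pbar) (_ : OrderTop Pbar),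
      ForcingEquiv (I.Stage ⊤) (Q ⊥ × Pbar) := by
  have hprod : IsCCC (I.Stage ⊤ × Q ⊥) := FStmt.isCCC_prod_of_forced hI (c ⊥) hQ₀
  -- Identifying equivalent sequences turns the preorder into a partial order without affecting
  -- density or incompatibility.
  refine ⟨Antisymmetrization (FSIteration.Tail I c) (· ≤ ·), inferInstance,
    { top := toAntisymmetrization (· ≤ ·) ⊤, le_top := ?_ },
    forcingEquiv_of_isDenseOrderEmbedding (FSIteration.isDenseOrderEmbedding_fst hQ hprod)
      ((isDenseOrderEmbedding_prodMap_toAntisymmetrization _ _).comp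
        (FSIteration.isDenseOrderEmbedding_snd hQ hprod))⟩
  intro s
  induction s using Quotient.inductionOn with
  | h s => exact (le_top : s ≤ ⊤)
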